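/- Let $T$ be a tree, regarded as an oriented graph with vertex set $V$, edge set $E$ and incidence maps $\iota,\tau\colon E\to V$, and let a group $G$ act on $T$ (i.e. $G$ acts on $V$ and on $E$ with $\iota(ge)=g\iota(e)$ and $\tau(ge)=g\tau(e)$; in particular, there are no inversions). Suppose that: 1. there is $M\in\mathbb{N}$ such that the stabilizer $G_v$ of every vertex $v\in V$ is a free abelian group of finite rank at most $M$; 2. for every edge $e\in E$, the stabilizer $G_e$ is a direct factor of $G_{\iota(e)}$ and of $G_{\tau(e)}$; 3. for all $x,y,z\in G$, if $xy=yx$ and $zxz^{-1}=y$, then $x=y$. If $G$ is not solvable, then there is a surjective homomorphism from $G$ onto $\mathbb{F}_2$, the free group of rank $2$. -/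

import Mathlib

/-- An oriented graph with vertex set `V` and edge set `E`: every edge `e` starts at `ι e` and ends
at `τ e`. Loops and multiple edges are allowed. -/
structure OrientedGraph (V E : Type*) where
  /-- initial vertex of an edge -/
  ι : E → V
  /-- terminal vertex of an edge -/
  τ : E → V

namespace OrientedGraph

variable {V E : Type*}

/-- The simple graph obtained by forgetting orientations, loops and multiplicities of edges. -/
def toSimpleGraph (T : OrientedGraph V E) : SimpleGraph V :=
  SimpleGraph.fromRel fun u v => ∃ e, T.ι e = u ∧ T.τ e = v

/-- An oriented graph is a tree if it is non-empty, connected and has no circuit: there is no loop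
(circuit of length one), no two distinct edges share both endpoints (circuit of length two), and the
underlying simple graph is connected and acyclic. -/
structure IsTree (T : OrientedGraph V E) : Prop where
  no_loop : ∀ e, T.ι e ≠ T.τ e
  no_multi : ∀ e f, s(T.ι e, T.τ e) = s(T.ι f, T.τ f) → e = f
  isTree : T.toSimpleGraph.IsTree

/-- Actions of `G` on the vertices and on the edges form an action on the oriented graph `T` if they
are compatible with the incidence maps. -/
structure IsAction (T : OrientedGraph V E) (G : Type*) [Group G] [MulAction G V] [MulAction G E] :
    Prop where
  ι_smul : ∀ (g : G) (e : E), T.ι (g • e) = g • T.ι e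
  τ_smul : ∀ (g : G) (e : E), T.τ (g • e) = g • T.τ e

end OrientedGraph

/-- The group `A` is free abelian of finite rank at most `M`. -/
def IsFreeAbelianOfRankLE (A : Type*) [Group A] (M : ℕ) : Prop :=
  ∃ n ≤ M, Nonempty (A ≃* Multiplicative (Fin n → ℤ))

/-- The subgroup `H` is a direct factor of the subgroup `A`: there is a subgroup `K` such that `A` is
the internal direct product of `H` and `K`. -/
def Subgroup.IsDirectFactorOf {G : Type*} [Group G] (H A : Subgroup G) : Prop :=
  ∃ K : Subgroup G, (∀ h ∈ H, ∀ k ∈ K, h * k = k * h) ∧ H ⊓ K = ⊥ ∧ H ⊔ K = A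

/-! It suffices to show that `G` is commutative if all its homomorphisms to the free group on `a`,
`b` have commutative image. Indeed a non-commutative image is free by Nielsen–Schreier, of rank at
least two, and so maps onto the free group of rank two.

Let `S` be a lift of a maximal subtree of the quotient graph, and call an edge outer if no translate
of it lies in `S`. As in Bass–Serre theory, compatible homomorphisms on the stabilizers over `S`
that kill the outer edge groups extend to `G`, with arbitrary values on the stable letters
(`IsTreeTransversal.exists_hom`). Since edge groups are direct factors, there are characters of a
vertex group that kill an edge group (`IsTame.exists_character`), and homomorphisms prescribed on a
subtree extend along retractions (`exists_family`). Each obstruction to commutativity is turned into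
a homomorphism whose image contains non-commuting powers of `a` and `b`.

Two orbits of outer edges would give stable letters mapping to `a` and `b`, so there is at most one
orbit. If there is none, the stabilizers along a path in `S` cannot drop at its start and rise at
its end; hence the stabilizers over `S`, which generate `G`, commute with each other.

If there is one orbit, a path in `S` closes up to a line, periodic under a stable letter `t`. An
element fixing a vertex and its translate by `t` commutes with `t`, by the hypothesis on commuting
conjugates, so fixing a full period means fixing the whole line. If the stabilizers varied along the
line, a longest segment fixed by an element not fixing the line would carry a character, extended
along the segment up to a multiple, which together with `t ↦ b` contradicts the assumption
(`mem_stabilizer_of_maximal`). So they are constant on the line; off the line they only get smaller,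
and all of them commute with `t`. -/

/-! ### Rooted trees, convex sets and paths -/

/-- A tree rooted at `r`: every vertex has a parent and a depth, and each edge joins a vertex to its
parent. -/
structure SimpleGraph.Rooting {V : Type*} (X : SimpleGraph V) (r : V) where
  par : V → V
  depth : V → ℕ
  depth_root : depth r = 0
  adj_par : ∀ v, v ≠ r → X.Adj v (par v)
  depth_par : ∀ v, v ≠ r → depth v = depth (par v) + 1
  par_of_adj : ∀ u w, X.Adj u w → (u ≠ r ∧ par u = w) ∨ (w ≠ r ∧ par w = u)

/-- A set of vertices is path-convex if it contains all paths joining its elements. -/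
def SimpleGraph.PathConvex {V : Type*} (X : SimpleGraph V) (S : Set V) : Prop :=
  ∀ ⦃u w : V⦄ (p : X.Walk u w), p.IsPath → u ∈ S → w ∈ S → ∀ x ∈ p.support, x ∈ S

namespace SimpleGraph

variable {V : Type*} {X : SimpleGraph V}

theorem IsTree.exists_rooting (hX : X.IsTree) (r : V) :
    ∃ R : X.Rooting r, ∀ S, X.PathConvex S → r ∈ S → ∀ v ∈ S, R.par v ∈ S := by
  classical
  choose p hp hu using fun v => hX.existsUnique_path v r
  have hnil : p r = Walk.nil := (hu r _ Walk.IsPath.nil).symm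
  have hnn : ∀ v, v ≠ r → ¬ (p v).Nil := fun v hv h => hv h.eq
  refine ⟨⟨fun v => (p v).snd, fun v => (p v).length, by simp [hnil], fun v hv => (p v).adj_snd (hnn v hv),
    fun v hv => ?_, fun u w h => ?_⟩, fun S hS hr v hv => ?_⟩
  · have : p (p v).snd = (p v).tail := (hu _ _ (hp v).tail).symm
    rw [this]
    exact ((p v).length_tail_add_one (hnn v hv)).symm
  · by_cases hw : w ∈ (p u).support
    · left
      have hur : u ≠ r := by
        rintro rfl
        rw [hnil] at hw
        simp at hw
        exact h.ne hw.symm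
      exact ⟨hur, (hX.isAcyclic.eq_snd_of_adj_start (hp u) h hw).symm⟩
    · right
      refine ⟨fun e => hw (e ▸ (p u).end_mem_support), ?_⟩
      have : (Walk.cons h.symm (p u)) = p w := hu _ _ ((hp u).cons hw)
      rw [← this]
      simp
  · exact hS (p v) (hp v) hv hr _ (by simp)

theorem Rooting.exists_recursion {r : V} (R : X.Rooting r) {A : Type*} (a : A) (step : V → A → A) :
    ∃ val : V → A, val r = a ∧ ∀ v, v ≠ r → val v = step v (val (R.par v)) := by
  -- Recursion on the depth: `F n v` is the intended value only for `n = depth v`.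
  let F : ℕ → V → A := fun n => Nat.rec (fun _ => a) (fun _ F v => step v (F (R.par v))) n
  refine ⟨fun v => F (R.depth v) v, by simp [R.depth_root, F], fun v hv => ?_⟩
  simp only [R.depth_par v hv, F]

/-- Induction from the root outwards. -/
theorem Rooting.induction {r : V} (R : X.Rooting r) {P : V → Prop} (h0 : P r)
    (hs : ∀ v, v ≠ r → P (R.par v) → P v) (v : V) : P v := by
  induction hn : R.depth v generalizing v with
  | zero =>
    by_cases hv : v = r
    · exact hv ▸ h0
    · have := R.depth_par v hv
      omega
  | succ n ih =>
    by_cases hv : v = r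
    · exact hv ▸ h0
    · have := R.depth_par v hv
      exact hs v hv (ih _ (by omega))

theorem Rooting.par_eq_of_adj_root {r : V} (R : X.Rooting r) {u : V} (h : X.Adj u r) :
    R.par u = r := by
  rcases R.par_of_adj _ _ h with h | h
  · exact h.2
  · exact absurd rfl h.1

theorem PathConvex.insert (hX : X.IsTree) {S : Set V} (hS : X.PathConvex S) {s x : V} (hs : s ∈ S)
    (h : X.Adj x s) : X.PathConvex (insert x S) := by
  classical
  by_cases hx : x ∈ S
  · rwa [Set.insert_eq_of_mem hx]
  -- A path from `x` into `S` runs through `s`: the path from `s` stays in `S`, hence avoids `x` and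
  -- can be prolonged by it.
  have key : ∀ w ∈ S, ∀ p : X.Walk x w, p.IsPath → ∀ y ∈ p.support, y ∈ Insert.insert x S := by
    intro w hw p hp y hy
    obtain ⟨q, hq, -⟩ := hX.existsUnique_path s w
    have hqS := hS q hq hs hw
    have hc : (Walk.cons h q).IsPath := hq.cons fun hxq => hx (hqS x hxq)
    rw [(hX.existsUnique_path x w).unique hp hc] at hy
    rw [Walk.support_cons, List.mem_cons] at hy
    rcases hy with rfl | hy
    · exact Set.mem_insert _ _
    · exact Set.mem_insert_of_mem _ (hqS y hy)
  intro u w p hp hu hw y hy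
  rcases hu with rfl | hu
  · rcases hw with rfl | hw
    · have := (Walk.isPath_iff_nil.1 hp).eq_nil
      subst this
      simp at hy
      simp [hy]
    · exact key w hw p hp y hy
  · rcases hw with rfl | hw
    · exact key u hu p.reverse hp.reverse y (by simpa using hy)
    · exact Set.mem_insert_of_mem _ (hS p hp hu hw y hy)

theorem pathConvex_singleton (v : V) : X.PathConvex {v} := by
  intro u w p hp hu hw y hy
  obtain rfl : u = v := hu
  obtain rfl : w = u := hw
  have := (Walk.isPath_iff_nil.1 hp).eq_nil
  subst this
  simpa using hy

/-- The first `m + 1` terms of a sequence of vertices form a path. -/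
structure IsPathSeq (X : SimpleGraph V) (m : ℕ) (v : ℕ → V) : Prop where
  adj : ∀ i < m, X.Adj (v i) (v (i + 1))
  inj : ∀ i ≤ m, ∀ j ≤ m, v i = v j → i = j

theorem IsPathSeq.mono {m k : ℕ} {v : ℕ → V} (h : X.IsPathSeq m v) (hk : k ≤ m) :
    X.IsPathSeq k v :=
  ⟨fun i hi => h.adj i (by omega), fun i hi j hj => h.inj i (by omega) j (by omega)⟩

theorem IsPathSeq.tail {m : ℕ} {v : ℕ → V} (h : X.IsPathSeq (m + 1) v) :
    X.IsPathSeq m (fun i => v (i + 1)) :=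
  ⟨fun i hi => h.adj (i + 1) (by omega), fun i hi j hj e => by
    have := h.inj (i + 1) (by omega) (j + 1) (by omega) e
    omega⟩

theorem IsPathSeq.pathConvex (hX : X.IsTree) {m : ℕ} {v : ℕ → V} (h : X.IsPathSeq m v) :
    X.PathConvex {x | ∃ i ≤ m, x = v i} := by
  induction m with
  | zero =>
    convert X.pathConvex_singleton (v 0)
    ext
    simp
  | succ m ih =>
    have := (ih (h.mono (by omega))).insert hX (s := v m) (x := v (m + 1)) ⟨m, le_rfl, rfl⟩
      (h.adj m (by omega)).symm
    convert this using 1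
    ext x
    simp only [Set.mem_ofPred_eq, Set.mem_insert_iff]
    constructor
    · rintro ⟨i, hi, rfl⟩
      rcases hi.lt_or_eq with hi | rfl
      · exact Or.inr ⟨i, by omega, rfl⟩
      · exact Or.inl rfl
    · rintro (rfl | ⟨i, hi, rfl⟩)
      · exact ⟨_, le_rfl, rfl⟩
      · exact ⟨i, by omega, rfl⟩

theorem IsPathSeq.par_succ {m : ℕ} {v : ℕ → V} (h : X.IsPathSeq m v) (R : X.Rooting (v 0)) {i : ℕ}
    (hi : i < m) : R.par (v (i + 1)) = v i := by
  induction i with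
  | zero => exact R.par_eq_of_adj_root (h.adj 0 hi).symm
  | succ i ih =>
    rcases R.par_of_adj _ _ (h.adj (i + 1) hi) with h1 | h1
    · have := ih (by omega)
      have := h.inj i (by omega) (i + 1 + 1) (by omega) (this.symm.trans h1.2)
      omega
    · exact h1.2

theorem PathConvex.exists_isPathSeq (hX : X.IsTree) {S : Set V} (hS : X.PathConvex S) {u w : V}
    (hu : u ∈ S) (hw : w ∈ S) :
    ∃ (m : ℕ) (v : ℕ → V), X.IsPathSeq m v ∧ v 0 = u ∧ v m = w ∧ ∀ i, v i ∈ S := by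
  obtain ⟨p, hp, -⟩ := hX.existsUnique_path u w
  refine ⟨p.length, p.getVert, ⟨fun i hi => p.adj_getVert_succ hi, fun i hi j hj e =>
    hp.getVert_injOn hi hj e⟩, by simp, by simp, fun i => hS p hp hu hw _ (p.getVert_mem_support i)⟩

end SimpleGraph

/-! ### The free group of rank two -/

open FreeGroup in
theorem freeGroup_zpow_not_comm {m l : ℤ} (hm : m ≠ 0) (hl : l ≠ 0) :
    (of (0 : Fin 2)) ^ m * (of 1) ^ l ≠ (of 1) ^ l * (of 0) ^ m := by
  intro h
  -- Map the generators to an upper and a lower unitriangular matrix. The upper left entries of the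
  -- two products are `1 - m * l` and `1`.
  obtain ⟨F, e0, e1⟩ : ∃ F : FreeGroup (Fin 2) →* Matrix.SpecialLinearGroup (Fin 2) ℤ,
      F (of 0) = ModularGroup.T ∧ F (of 1) = ModularGroup.S * ModularGroup.T * ModularGroup.S⁻¹ :=
    ⟨FreeGroup.lift ![ModularGroup.T, ModularGroup.S * ModularGroup.T * ModularGroup.S⁻¹],
      by simp, by simp⟩
  have h2 := congrArg F h
  rw [_root_.map_mul, _root_.map_mul, map_zpow, map_zpow] at h2
  rw [e0, e1, conj_zpow] at h2
  have hU : ((ModularGroup.S * ModularGroup.T ^ l * ModularGroup.S⁻¹ :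
      Matrix.SpecialLinearGroup (Fin 2) ℤ) : Matrix (Fin 2) (Fin 2) ℤ) = !![1, 0; -l, 1] := by
    rw [Matrix.SpecialLinearGroup.coe_mul, Matrix.SpecialLinearGroup.coe_mul, ModularGroup.coe_T_zpow,
      Matrix.SpecialLinearGroup.coe_inv, ModularGroup.coe_S, Matrix.adjugate_fin_two_of]
    simp
  have h3 := congrArg (fun A : Matrix.SpecialLinearGroup (Fin 2) ℤ => (A : Matrix (Fin 2) (Fin 2) ℤ)) h2
  simp only [Matrix.SpecialLinearGroup.coe_mul _ (ModularGroup.T ^ m),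
    Matrix.SpecialLinearGroup.coe_mul (ModularGroup.T ^ m), hU, ModularGroup.coe_T_zpow,
    Matrix.mul_fin_two] at h3
  have h4 := congrFun (congrFun h3 0) 0
  simp [hm, hl] at h4

theorem exists_surjective_freeGroup_two_of_not_comm {G : Type*} [Group G]
    (f : G →* FreeGroup (Fin 2)) {x y : G} (hxy : f x * f y ≠ f y * f x) :
    ∃ f : G →* FreeGroup (Fin 2), Function.Surjective f := by
  classical
  let e : f.range ≃* FreeGroup (IsFreeGroup.Generators f.range) := IsFreeGroup.toFreeGroup f.range
  have hnt : Nontrivial (IsFreeGroup.Generators f.range) := by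
    by_contra hn
    rw [not_nontrivial_iff_subsingleton] at hn
    apply hxy
    have hc : ∀ a b : FreeGroup (IsFreeGroup.Generators f.range), a * b = b * a := by
      rcases isEmpty_or_nonempty (IsFreeGroup.Generators f.range) with h | h
      · intro a b
        exact Subsingleton.elim _ _
      · obtain ⟨i⟩ := h
        have : ∀ a : FreeGroup (IsFreeGroup.Generators f.range),
            a ∈ Subgroup.zpowers (FreeGroup.of i) := by
          intro a
          induction a using FreeGroup.induction_on with
          | C1 => exact one_mem _
          | of j => rw [Subsingleton.elim j i]; exact Subgroup.mem_zpowers _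
          | inv_of j hj => exact inv_mem hj
          | mul a b ha hb => exact mul_mem ha hb
        intro a b
        obtain ⟨m, rfl⟩ := this a
        obtain ⟨n, rfl⟩ := this b
        exact (Commute.refl _).zpow_zpow m n
    have h1 : (⟨f x, x, rfl⟩ : f.range) * ⟨f y, y, rfl⟩ = ⟨f y, y, rfl⟩ * ⟨f x, x, rfl⟩ := by
      apply e.injective
      rw [map_mul, map_mul, hc]
    exact congrArg Subtype.val h1
  obtain ⟨i, j, hij⟩ := hnt
  -- Two distinct generators suffice; all generators other than `i` may share one image.
  let g : FreeGroup (IsFreeGroup.Generators f.range) →* FreeGroup (Fin 2) :=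
    FreeGroup.lift fun k => if k = i then FreeGroup.of 0 else FreeGroup.of 1
  have hg : Function.Surjective g := by
    intro z
    change z ∈ g.range
    induction z using FreeGroup.induction_on with
    | C1 => exact one_mem _
    | of k =>
      fin_cases k
      · exact ⟨FreeGroup.of i, by simp [g]⟩
      · exact ⟨FreeGroup.of j, by simp [g, hij.symm]⟩
    | inv_of k hk => exact inv_mem hk
    | mul a b ha hb => exact mul_mem ha hb
  exact ⟨g.comp (e.toMonoidHom.comp f.rangeRestrict),
    hg.comp (e.surjective.comp f.rangeRestrict_surjective)⟩

/-! ### Homomorphisms on subgroups and direct factors -/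

/-- `f` restricts to a homomorphism on the subgroup `A`. -/
def MulOn {G L : Type*} [Group G] [Group L] (A : Subgroup G) (f : G → L) : Prop :=
  ∀ x ∈ A, ∀ y ∈ A, f (x * y) = f x * f y

section MulOn

variable {G L : Type*} [Group G] [Group L] {A : Subgroup G} {f : G → L}

theorem MulOn.map_one (h : MulOn A f) : f 1 = 1 := by
  have := h 1 (one_mem A) 1 (one_mem A)
  simpa using this

/-- The homomorphism defined on `A` by a function that is multiplicative on `A`. -/
def MulOn.toHom (h : MulOn A f) : A →* L where
  toFun x := f x
  map_one' := h.map_one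
  map_mul' x y := h x x.2 y y.2

end MulOn

/-- The projections `p` to `H` and `q` to a complement, as functions on `G` that matter only on `A`.
They are multiplicative because the decomposition of an element is unique. -/
theorem Subgroup.IsDirectFactorOf.exists_mul {G : Type*} [Group G] {H A : Subgroup G}
    (h : H.IsDirectFactorOf A) : ∃ p q : G → G, (∀ x ∈ A, p x ∈ H ∧ x = p x * q x) ∧ MulOn A p ∧
      MulOn A q ∧ (∀ x ∈ H, p x = x ∧ q x = 1) ∧ (∀ x ∈ A, q x = 1 → x ∈ H) ∧ ∀ x ∈ A, q x ∈ A := by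
  classical
  obtain ⟨K, hc, hi, hs⟩ := h
  have hdec : ∀ x ∈ A, ∃ a ∈ H, ∃ b ∈ K, x = a * b := by
    let P : Subgroup G :=
      { carrier := {x | ∃ a ∈ H, ∃ b ∈ K, x = a * b}
        one_mem' := ⟨1, one_mem _, 1, one_mem _, by simp⟩
        mul_mem' := by
          rintro _ _ ⟨a, ha, b, hb, rfl⟩ ⟨c, hc', d, hd, rfl⟩
          refine ⟨a * c, mul_mem ha hc', b * d, mul_mem hb hd, ?_⟩
          have := hc c hc' b hb
          simp only [mul_assoc]
          rw [← mul_assoc b c d, ← this, mul_assoc]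
        inv_mem' := by
          rintro _ ⟨a, ha, b, hb, rfl⟩
          refine ⟨a⁻¹, inv_mem ha, b⁻¹, inv_mem hb, ?_⟩
          rw [hc a ha b hb, mul_inv_rev] }
    have hP : A ≤ P := by
      rw [← hs]
      exact sup_le (fun x hx => ⟨x, hx, 1, one_mem _, by simp⟩)
        (fun x hx => ⟨1, one_mem _, x, hx, by simp⟩)
    exact fun x hx => hP hx
  have hHA : H ≤ A := hs ▸ le_sup_left
  have hKA : K ≤ A := hs ▸ le_sup_right
  have huniq : ∀ a ∈ H, ∀ b ∈ K, ∀ c ∈ H, ∀ d ∈ K, a * b = c * d → a = c ∧ b = d := by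
    intro a ha b hb c hc' d hd e
    have h1 : c⁻¹ * a = d * b⁻¹ := by
      rw [inv_mul_eq_iff_eq_mul, ← mul_assoc, ← e, mul_inv_cancel_right]
    have h2 : c⁻¹ * a ∈ H ⊓ K := ⟨H.mul_mem (H.inv_mem hc') ha, by
      rw [h1]; exact K.mul_mem hd (K.inv_mem hb)⟩
    rw [hi, Subgroup.mem_bot] at h2
    have h3 := h1.symm.trans h2
    exact ⟨(inv_mul_eq_one.1 h2).symm, (mul_inv_eq_one.1 h3).symm⟩
  choose! p hp q hq hpq using hdec
  have hmul : ∀ x ∈ A, ∀ y ∈ A, p (x * y) = p x * p y ∧ q (x * y) = q x * q y := by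
    intro x hx y hy
    refine huniq _ (hp _ (mul_mem hx hy)) _ (hq _ (mul_mem hx hy)) _ (mul_mem (hp x hx) (hp y hy)) _
      (mul_mem (hq x hx) (hq y hy)) ?_
    rw [← hpq _ (mul_mem hx hy)]
    nth_rewrite 1 [hpq x hx, hpq y hy]
    have := hc _ (hp y hy) _ (hq x hx)
    simp only [mul_assoc]
    rw [← mul_assoc (q x) (p y) (q y), ← this, mul_assoc]
  refine ⟨p, q, fun x hx => ⟨hp x hx, hpq x hx⟩, fun x hx y hy => (hmul x hx y hy).1,
    fun x hx y hy => (hmul x hx y hy).2, fun x hx => ?_, fun x hx e => ?_, fun x hx => hKA (hq x hx)⟩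
  · exact huniq _ (hp x (hHA hx)) _ (hq x (hHA hx)) x hx 1 (one_mem _)
      (by rw [mul_one, ← hpq x (hHA hx)])
  · rw [hpq x hx, e, mul_one]
    exact hp x hx

/-! ### Characters of free abelian groups and their extension -/

theorem IsFreeAbelianOfRankLE.comm {A : Type*} [Group A] {M : ℕ} (h : IsFreeAbelianOfRankLE A M)
    (x y : A) : x * y = y * x := by
  obtain ⟨n, -, ⟨e⟩⟩ := h
  apply e.injective
  rw [map_mul, map_mul, mul_comm]

theorem IsFreeAbelianOfRankLE.exists_hom_ne {A : Type*} [Group A] {M : ℕ}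
    (h : IsFreeAbelianOfRankLE A M) {x : A} (hx : x ≠ 1) :
    ∃ f : A →* Multiplicative ℤ, f x ≠ 1 := by
  obtain ⟨n, -, ⟨e⟩⟩ := h
  have h1 : e x ≠ 1 := fun h => hx (e.injective (h.trans (map_one e).symm))
  have h2 : ∃ i, (e x).toAdd i ≠ 0 := by
    by_contra! hn
    exact h1 (Multiplicative.toAdd.injective (funext hn))
  obtain ⟨i, hi⟩ := h2
  refine ⟨(AddMonoidHom.toMultiplicative (Pi.evalAddMonoidHom (fun _ : Fin n => ℤ) i)).comp e.toMonoidHom, ?_⟩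
  intro h3
  exact hi (congrArg Multiplicative.toAdd h3)

/-- A homomorphism from a finitely generated free abelian group to the rationals has a non-zero
integral multiple with integral values. -/
theorem IsFreeAbelianOfRankLE.exists_integral {A : Type*} [Group A] {M : ℕ}
    (h : IsFreeAbelianOfRankLE A M) (f : A →* Multiplicative ℚ) :
    ∃ N : ℤ, N ≠ 0 ∧ ∀ x, ∃ z : ℤ, N * (f x).toAdd = z := by
  obtain ⟨n, -, ⟨e⟩⟩ := h
  let g : (Fin n → ℤ) →+ ℚ := MonoidHom.toAdditiveLeft (f.comp e.symm.toMonoidHom)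
  have hg : ∀ x, (f x).toAdd = g (e x).toAdd := fun x => by
    change _ = (f (e.symm (e x))).toAdd
    rw [e.symm_apply_apply]
  -- The product of the denominators of the values on a basis.
  refine ⟨∏ i, ((g (Pi.single i 1)).den : ℤ),
    Finset.prod_ne_zero_iff.2 fun i _ => by exact_mod_cast (g (Pi.single i 1)).den_nz, fun x => ?_⟩
  rw [hg]
  generalize (e x).toAdd = y
  have hy : g y = ∑ i, (y i : ℚ) * g (Pi.single i 1) := by
    have : y = ∑ i, y i • (Pi.single i (1 : ℤ) : Fin n → ℤ) := by
      ext j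
      simp [Finset.sum_apply, Pi.single_apply]
    conv_lhs => rw [this, map_sum]
    exact Finset.sum_congr rfl fun i _ => by rw [map_zsmul, zsmul_eq_mul]
  rw [hy, Finset.mul_sum]
  have hz : ∀ i, ∃ z : ℤ, ((∏ i, ((g (Pi.single i 1)).den : ℤ) : ℤ) : ℚ) * (y i * g (Pi.single i 1)) = z := by
    intro i
    obtain ⟨c, hc⟩ := Finset.dvd_prod_of_mem (fun i => ((g (Pi.single i 1)).den : ℤ)) (Finset.mem_univ i)
    refine ⟨c * y i * (g (Pi.single i 1)).num, ?_⟩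
    rw [hc]
    push_cast
    have := Rat.mul_den_eq_num (g (Pi.single i 1))
    rw [← this]
    ring
  choose z hz using hz
  exact ⟨∑ i, z i, by rw [Int.cast_sum]; exact Finset.sum_congr rfl fun i _ => hz i⟩

/-- Extension of a rational character from `C` to `A`, with prescribed vanishing on `F`. -/
theorem exists_extension_rat {A : Type*} [AddCommGroup A] (C F : AddSubgroup A) (χ : C →+ ℚ)
    (h : ∀ x : C, (x : A) ∈ F → χ x = 0) :
    ∃ ψ : A →+ ℚ, (∀ x : C, ψ x = χ x) ∧ ∀ x ∈ F, ψ x = 0 := by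
  let f : C →+ A ⧸ F := (QuotientAddGroup.mk' F).comp C.subtype
  have hk : f.ker ≤ χ.ker := fun x hx => h x ((QuotientAddGroup.eq_zero_iff _).1 hx)
  -- `C` modulo the kernel of `C → A ⧸ F` embeds in `A ⧸ F`, and `χ` descends to this quotient of
  -- `C`; divisibility of `ℚ` extends it.
  obtain ⟨g, hg⟩ := (Module.Baer.of_divisible ℚ).extension_property_addMonoidHom
    (QuotientAddGroup.kerLift f) (QuotientAddGroup.kerLift_injective f)
    (QuotientAddGroup.lift f.ker χ hk)
  refine ⟨g.comp (QuotientAddGroup.mk' F), fun x => ?_, fun x hx => ?_⟩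
  · exact DFunLike.congr_fun hg (x : C ⧸ f.ker)
  · have : (QuotientAddGroup.mk' F) x = 0 := (QuotientAddGroup.eq_zero_iff x).2 hx
    rw [AddMonoidHom.comp_apply, this, map_zero]

theorem exists_mulOn_extension {G : Type*} [Group G] {A C F : Subgroup G}
    (hA : ∀ x ∈ A, ∀ y ∈ A, x * y = y * x) (hC : C ≤ A) (hF : F ≤ A) {χ : G → Multiplicative ℚ}
    (hχ : MulOn C χ) (h0 : ∀ x ∈ C, x ∈ F → χ x = 1) :
    ∃ ψ : G → Multiplicative ℚ, MulOn A ψ ∧ (∀ x ∈ C, ψ x = χ x) ∧ ∀ x ∈ F, ψ x = 1 := by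
  classical
  let _ : CommGroup A := { (inferInstance : Group A) with
    mul_comm := fun x y => Subtype.ext (hA x x.2 y y.2) }
  let C' : AddSubgroup (Additive A) := (C.subgroupOf A).toAddSubgroup
  let F' : AddSubgroup (Additive A) := (F.subgroupOf A).toAddSubgroup
  let χ' : C' →+ ℚ :=
    { toFun := fun x => (χ (x.1.toMul : A)).toAdd
      map_zero' := congrArg Multiplicative.toAdd hχ.map_one
      map_add' := fun x y => congrArg Multiplicative.toAdd (hχ _ x.2 _ y.2) }
  obtain ⟨ψ, h1, h2⟩ := exists_extension_rat C' F' χ' fun x hx =>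
    congrArg Multiplicative.toAdd (h0 _ x.2 hx)
  refine ⟨fun x => if hx : x ∈ A then Multiplicative.ofAdd (ψ (Additive.ofMul ⟨x, hx⟩)) else 1,
    fun x hx y hy => ?_, fun x hx => ?_, fun x hx => ?_⟩
  · simp only [hx, hy, mul_mem hx hy, dite_true, ← ofAdd_add, ← map_add]
    rfl
  · simp only [hC hx, dite_true]
    exact congrArg Multiplicative.ofAdd (h1 ⟨Additive.ofMul ⟨x, hC hx⟩, hx⟩)
  · simp only [hF hx, dite_true]
    exact congrArg Multiplicative.ofAdd (h2 (Additive.ofMul ⟨x, hF hx⟩) hx)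

/-- Extension of a rational character along a sequence of abelian subgroups. -/
theorem exists_rat_sequence {G : Type*} [Group G] (k : ℕ) (A : ℕ → Subgroup G)
    (hA : ∀ i, ∀ x ∈ A i, ∀ y ∈ A i, x * y = y * x) (ψ : G → Multiplicative ℚ) (hψ : MulOn (A 0) ψ)
    (h0 : ∀ x, (∀ i ≤ k + 1, x ∈ A i) → ψ x = 1) :
    ∃ Ψ : ℕ → G → Multiplicative ℚ, Ψ 0 = ψ ∧ (∀ i ≤ k, MulOn (A i) (Ψ i)) ∧
      (∀ i < k, ∀ x ∈ A i, x ∈ A (i + 1) → Ψ i x = Ψ (i + 1) x) ∧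
      ∀ x ∈ A k, x ∈ A (k + 1) → Ψ k x = 1 := by
  induction k generalizing A ψ with
  | zero =>
    refine ⟨fun _ => ψ, rfl, ?_, by simp, fun x hx hx1 => h0 x ?_⟩
    · intro i hi
      obtain rfl : i = 0 := by omega
      exact hψ
    · intro i hi
      obtain rfl | rfl : i = 0 ∨ i = 1 := by omega
      · exact hx
      · exact hx1
  | succ k ih =>
    -- Vanishing on the intersection of `A 1, …, A (k + 2)` is the hypothesis needed to continue
    -- from `A 1`. It is consistent with `ψ` on `A 0 ⊓ A 1` by `h0`.
    let F : Subgroup G := ⨅ i : Fin (k + 2), A (i + 1)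
    have hF : ∀ x, x ∈ F ↔ ∀ i ≤ k + 1, x ∈ A (i + 1) := fun x => by
      simp only [F, Subgroup.mem_iInf, Fin.forall_iff]
      exact forall_congr' fun i => ⟨fun h hi => h (by omega), fun h hi => h (by omega)⟩
    obtain ⟨ψ1, h1, h2, h3⟩ := exists_mulOn_extension (A := A 1) (C := A 0 ⊓ A 1) (F := F) (hA 1)
      inf_le_right (fun x hx => (hF x).1 hx 0 (by omega)) (χ := ψ)
      (fun x hx y hy => hψ x hx.1 y hy.1) (fun x hx hxF => h0 x fun i hi => by
        rcases i with _ | i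
        · exact hx.1
        · exact (hF x).1 hxF i (by omega))
    obtain ⟨Ψ, e0, e1, e2, e3⟩ := ih (fun i => A (i + 1)) (fun i => hA _) ψ1 h1
      (fun x hx => h3 x ((hF x).2 hx))
    refine ⟨fun i => i.casesOn ψ Ψ, rfl, fun i hi => ?_, fun i hi x hx hx' => ?_, e3⟩
    · rcases i with _ | i
      · exact hψ
      · exact e1 i (by omega)
    · rcases i with _ | i
      · simp only [e0]
        exact (h2 x ⟨hx, hx'⟩).symm
      · exact e2 i (by omega) x hx hx'

/-- Extension of an integral character along a sequence of finitely generated free abelian subgroups,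
up to a non-zero multiple. -/
theorem exists_int_sequence {G : Type*} [Group G] {M : ℕ} (k : ℕ) (A : ℕ → Subgroup G)
    (hA : ∀ i, IsFreeAbelianOfRankLE (A i) M) (χ : G → Multiplicative ℤ) (hχ : MulOn (A 0) χ)
    (h0 : ∀ x, (∀ i ≤ k + 1, x ∈ A i) → χ x = 1) :
    ∃ (N : ℤ) (Ψ : ℕ → G → Multiplicative ℤ), N ≠ 0 ∧ (∀ x ∈ A 0, Ψ 0 x = χ x ^ N) ∧
      (∀ i ≤ k, MulOn (A i) (Ψ i)) ∧
      (∀ i < k, ∀ x ∈ A i, x ∈ A (i + 1) → Ψ i x = Ψ (i + 1) x) ∧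
      ∀ x ∈ A k, x ∈ A (k + 1) → Ψ k x = 1 := by
  obtain ⟨Φ, e0, e1, e2, e3⟩ := exists_rat_sequence k A
    (fun i x hx y hy => congrArg Subtype.val ((hA i).comm ⟨x, hx⟩ ⟨y, hy⟩))
    (fun x => Multiplicative.ofAdd ((χ x).toAdd : ℚ))
    (fun x hx y hy => by simp [hχ x hx y hy, ofAdd_add]) (fun x hx => by simp [h0 x hx])
  have hN : ∀ i, ∃ N : ℤ, N ≠ 0 ∧ (i ≤ k → ∀ x ∈ A i, ∃ z : ℤ, N * (Φ i x).toAdd = z) := by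
    intro i
    by_cases hi : i ≤ k
    · obtain ⟨N, hN, h⟩ := (hA i).exists_integral (e1 i hi).toHom
      exact ⟨N, hN, fun _ x hx => h ⟨x, hx⟩⟩
    · exact ⟨1, one_ne_zero, fun h => absurd h hi⟩
  choose N hN hNz using hN
  -- `P` clears all denominators at once, so the floors below are exact on each `A i`.
  let P : ℤ := ∏ i ∈ Finset.range (k + 1), N i
  have hP : ∀ i ≤ k, ∀ x ∈ A i, ((⌊(P : ℚ) * (Φ i x).toAdd⌋ : ℤ) : ℚ) = P * (Φ i x).toAdd := by
    intro i hi x hx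
    obtain ⟨c, hc⟩ := Finset.dvd_prod_of_mem N (Finset.mem_range.2 (Nat.lt_succ_of_le hi))
    obtain ⟨z, hz⟩ := hNz i hi x hx
    have : (P : ℚ) * (Φ i x).toAdd = ((c * z : ℤ) : ℚ) := by
      change ((∏ i ∈ Finset.range (k + 1), N i : ℤ) : ℚ) * _ = _
      rw [hc]
      push_cast
      rw [← hz]
      ring
    rw [this, Int.floor_intCast]
  refine ⟨P, fun i x => Multiplicative.ofAdd ⌊(P : ℚ) * (Φ i x).toAdd⌋,
    Finset.prod_ne_zero_iff.2 fun i _ => hN i, fun x hx => ?_, fun i hi x hx y hy => ?_,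
    fun i hi x hx hx' => by simp only [e2 i hi x hx hx'], fun x hx hx' => by simp [e3 x hx hx']⟩
  · simp only [e0, toAdd_ofAdd]
    have : (P : ℚ) * (χ x).toAdd = ((P * (χ x).toAdd : ℤ) : ℚ) := by push_cast; rfl
    rw [this, Int.floor_intCast]
    apply Multiplicative.toAdd.injective
    simp [mul_comm]
  · rw [← ofAdd_add]
    refine congrArg Multiplicative.ofAdd ?_
    apply Int.cast_injective (α := ℚ)
    push_cast
    rw [hP i hi _ (mul_mem hx hy), hP i hi x hx, hP i hi y hy, e1 i hi x hx y hy, toAdd_mul]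
    ring

/-! ### Homomorphisms from group actions on trees, and transversals -/

namespace OrientedGraph

variable {G V E : Type*} [Group G] [MulAction G V] [MulAction G E] {T : OrientedGraph V E}

theorem IsTree.adj_iff (hT : T.IsTree) {u w : V} :
    T.toSimpleGraph.Adj u w ↔ ∃ e, s(T.ι e, T.τ e) = s(u, w) := by
  rw [toSimpleGraph, SimpleGraph.fromRel_adj]
  constructor
  · rintro ⟨-, ⟨e, rfl, rfl⟩ | ⟨e, rfl, rfl⟩⟩
    · exact ⟨e, rfl⟩
    · exact ⟨e, Sym2.eq_swap⟩
  · rintro ⟨e, he⟩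
    rcases Sym2.eq_iff.1 he with ⟨rfl, rfl⟩ | ⟨rfl, rfl⟩
    · exact ⟨hT.no_loop e, Or.inl ⟨e, rfl, rfl⟩⟩
    · exact ⟨(hT.no_loop e).symm, Or.inr ⟨e, rfl, rfl⟩⟩

theorem IsTree.adj_edge (hT : T.IsTree) (e : E) : T.toSimpleGraph.Adj (T.ι e) (T.τ e) :=
  hT.adj_iff.2 ⟨e, rfl⟩

theorem IsAction.map_ends (hact : T.IsAction G) (g : G) {e : E} {u w : V}
    (h : s(T.ι e, T.τ e) = s(u, w)) : s(T.ι (g • e), T.τ (g • e)) = s(g • u, g • w) := by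
  rw [hact.ι_smul, hact.τ_smul]
  exact congrArg (Sym2.map (g • ·)) h

theorem IsAction.adj_smul (hT : T.IsTree) (hact : T.IsAction G) (g : G) {u w : V}
    (h : T.toSimpleGraph.Adj u w) : T.toSimpleGraph.Adj (g • u) (g • w) := by
  obtain ⟨e, he⟩ := hT.adj_iff.1 h
  exact hT.adj_iff.2 ⟨g • e, hact.map_ends g he⟩

theorem IsAction.mem_stabilizer_edge_iff (hT : T.IsTree) (hact : T.IsAction G) {e : E} {u w : V}
    (he : s(T.ι e, T.τ e) = s(u, w)) {g : G} :
    g ∈ MulAction.stabilizer G e ↔ g ∈ MulAction.stabilizer G u ∧ g ∈ MulAction.stabilizer G w := by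
  simp only [MulAction.mem_stabilizer_iff]
  have key : g • e = e ↔ g • T.ι e = T.ι e ∧ g • T.τ e = T.τ e := by
    constructor
    · intro h
      rw [← hact.ι_smul, ← hact.τ_smul, h]
      exact ⟨rfl, rfl⟩
    · rintro ⟨h1, h2⟩
      apply hT.no_multi
      rw [hact.ι_smul, hact.τ_smul, h1, h2]
  rw [key]
  rcases Sym2.eq_iff.1 he with ⟨rfl, rfl⟩ | ⟨rfl, rfl⟩
  · rfl
  · exact and_comm

/-- A cocycle on the vertices, trivialised along the edges, defines a homomorphism. -/
theorem IsAction.exists_hom_of_cocycle {L : Type*} [Group L] (hT : T.IsTree) (hact : T.IsAction G)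
    (r : V) (α : G → V → L) (hα : ∀ g h v, α (g * h) v = α g (h • v) * α h v) (β : E → L)
    (hβ : ∀ g e, α g (T.τ e) * β e = β (g • e) * α g (T.ι e)) :
    ∃ (f : G →* L) (b : V → L), b r = 1 ∧ (∀ e, b (T.τ e) = β e * b (T.ι e)) ∧
      ∀ g v, f g = (b (g • v))⁻¹ * α g v * b v := by
  classical
  obtain ⟨R, -⟩ := hT.isTree.exists_rooting r
  -- Transport from `u` to `w`: `β e` or its inverse, according to orientation, and `1` for
  -- non-adjacent vertices.
  have hstep : ∀ u w : V, ∃ c : L, (∀ e, T.ι e = u → T.τ e = w → c = β e) ∧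
      (∀ e, T.ι e = w → T.τ e = u → c = (β e)⁻¹) := by
    intro u w
    by_cases h : ∃ e, T.ι e = u ∧ T.τ e = w
    · obtain ⟨e, he1, he2⟩ := h
      refine ⟨β e, fun e' h1 h2 => ?_, fun e' h1 h2 => ?_⟩
      · rw [hT.no_multi e e' (by rw [he1, he2, h1, h2])]
      · obtain rfl := hT.no_multi e e' (by rw [he1, he2, h1, h2, Sym2.eq_swap])
        exact absurd (he1.trans h2.symm) (hT.no_loop e)
    · by_cases h' : ∃ e, T.ι e = w ∧ T.τ e = u
      · obtain ⟨e, he1, he2⟩ := h'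
        refine ⟨(β e)⁻¹, fun e' h1 h2 => absurd ⟨e', h1, h2⟩ h, fun e' h1 h2 => ?_⟩
        rw [hT.no_multi e e' (by rw [he1, he2, h1, h2])]
      · exact ⟨1, fun e' h1 h2 => absurd ⟨e', h1, h2⟩ h, fun e' h1 h2 => absurd ⟨e', h1, h2⟩ h'⟩
  choose c hc1 hc2 using hstep
  obtain ⟨b, hb0, hb⟩ := R.exists_recursion (1 : L) (fun v x => c (R.par v) v * x)
  have hbe : ∀ e, b (T.τ e) = β e * b (T.ι e) := by
    intro e
    rcases R.par_of_adj _ _ (hT.adj_edge e) with ⟨h1, h2⟩ | ⟨h1, h2⟩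
    · rw [hb _ h1, h2, hc2 _ _ e rfl rfl, mul_inv_cancel_left]
    · rw [hb _ h1, h2, hc1 _ _ e rfl rfl]
  -- By `hβ` the prospective value of `f g` is the same at both ends of an edge, hence at all
  -- vertices.
  have hedge : ∀ g e, (b (g • T.ι e))⁻¹ * α g (T.ι e) * b (T.ι e) =
      (b (g • T.τ e))⁻¹ * α g (T.τ e) * b (T.τ e) := by
    intro g e
    have h1 := hbe (g • e)
    rw [hact.ι_smul, hact.τ_smul] at h1
    rw [h1, hbe e, mul_assoc _ (α g (T.τ e)), ← mul_assoc (α g (T.τ e)), hβ]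
    group
  have hconst : ∀ g v, (b (g • v))⁻¹ * α g v * b v = (b (g • r))⁻¹ * α g r * b r := by
    intro g v
    refine R.induction (P := fun v => (b (g • v))⁻¹ * α g v * b v = (b (g • r))⁻¹ * α g r * b r) rfl
      (fun v hv ih => ?_) v
    rw [← ih]
    obtain ⟨e, he⟩ := hT.adj_iff.1 (R.adj_par v hv)
    rcases Sym2.eq_iff.1 he with ⟨h1, h2⟩ | ⟨h1, h2⟩
    · rw [← h2, ← h1]
      exact hedge g e
    · rw [← h1, ← h2]
      exact (hedge g e).symm
  refine ⟨MonoidHom.mk' (fun g => (b (g • r))⁻¹ * α g r * b r) fun g h => ?_, b, hb0, hbe,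
    fun g v => (hconst g v).symm⟩
  rw [← hconst g (h • r), hα, mul_smul]
  group

/-- An edge is inner for `S` if some translate has both ends in `S`. -/
def IsInner (T : OrientedGraph V E) (G : Type*) [Group G] [MulAction G E] (S : Set V) (e : E) :
    Prop :=
  ∃ g : G, T.ι (g • e) ∈ S ∧ T.τ (g • e) ∈ S

/-- A non-empty path-convex set of vertices meeting every orbit in exactly one vertex. -/
structure IsTreeTransversal (T : OrientedGraph V E) (G : Type*) [Group G] [MulAction G V]
    (S : Set V) : Prop where
  convex : T.toSimpleGraph.PathConvex S
  cover : ∀ v : V, ∃ g : G, g • v ∈ S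
  unique : ∀ u ∈ S, ∀ w ∈ S, ∀ g : G, g • u = w → u = w

theorem isInner_smul {K V E : Type*} [Group K] [MulAction K E] {T : OrientedGraph V E} {S : Set V}
    {e : E} (g : K) : T.IsInner K S (g • e) ↔ T.IsInner K S e := by
  constructor
  · rintro ⟨k, hk⟩
    exact ⟨k * g, by rwa [mul_smul]⟩
  · rintro ⟨k, hk⟩
    exact ⟨k * g⁻¹, by rwa [mul_smul, inv_smul_smul]⟩

/-- Homomorphisms defined on the vertex stabilizers over a tree transversal `S`, compatible on the
edges in `S` and trivial on the stabilizers of the remaining edges, extend to the whole group. The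
values on the stable letters are arbitrary. -/
theorem IsTreeTransversal.exists_hom {L : Type*} [Group L] {S : Set V}
    (hS : T.IsTreeTransversal G S) (hT : T.IsTree) (hact : T.IsAction G) (φ : V → G → L)
    (hφ : ∀ s ∈ S, MulOn (MulAction.stabilizer G s) (φ s))
    (hin : ∀ e, T.ι e ∈ S → T.τ e ∈ S → ∀ h ∈ MulAction.stabilizer G e, φ (T.ι e) h = φ (T.τ e) h)
    (hout : ∀ e, ¬ T.IsInner G S e → ∀ x ∈ S, (x = T.ι e ∨ x = T.τ e) →
      ∀ h ∈ MulAction.stabilizer G e, φ x h = 1)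
    (c : E → L) (hc : ∀ (g : G) e, c (g • e) = c e) (hc1 : ∀ e, T.IsInner G S e → c e = 1) :
    ∃ f : G →* L, (∀ s ∈ S, ∀ h ∈ MulAction.stabilizer G s, f h = φ s h) ∧
      ∀ e, ¬ T.IsInner G S e → ∃ t, f t = c e := by
  classical
  have hσ : ∀ v : V, ∃ g : G, g⁻¹ • v ∈ S ∧ (v ∈ S → g = 1) := by
    intro v
    by_cases hv : v ∈ S
    · exact ⟨1, by simpa using hv, fun _ => rfl⟩
    · obtain ⟨g, hg⟩ := hS.cover v
      exact ⟨g⁻¹, by simpa using hg, fun h => absurd h hv⟩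
  choose σ hσS hσ1 using hσ
  let p : V → V := fun v => (σ v)⁻¹ • v
  have hp : ∀ (g : G) v, p (g • v) = p v := fun g v =>
    hS.unique _ (hσS _) _ (hσS _) ((σ v)⁻¹ * g⁻¹ * σ (g • v)) (by simp [p, mul_smul])
  have hpS : ∀ v ∈ S, p v = v := fun v hv => by simp [p, hσ1 v hv]
  have hmem : ∀ (g : G) v, (σ (g • v))⁻¹ * g * σ v ∈ MulAction.stabilizer G (p v) := by
    intro g v
    rw [MulAction.mem_stabilizer_iff]
    nth_rewrite 2 [← hp g v]
    simp [p, mul_smul]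
  -- `σ v` carries the representative `p v` to `v`, so `g` acts from `v` to `g • v` through an
  -- element of the stabilizer of `p v`.
  let α : G → V → L := fun g v => φ (p v) ((σ (g • v))⁻¹ * g * σ v)
  have hα : ∀ g h v, α (g * h) v = α g (h • v) * α h v := by
    intro g h v
    simp only [α]
    rw [hp h v, ← hφ (p v) (hσS v) _ (hp h v ▸ hmem g (h • v)) _ (hmem h v), mul_smul]
    congr 1
    group
  have hαS : ∀ s ∈ S, ∀ h ∈ MulAction.stabilizer G s, α h s = φ s h := by
    intro s hs h hh
    simp only [α]
    rw [MulAction.mem_stabilizer_iff.1 hh, hσ1 s hs, hpS s hs]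
    simp
  have hασ : ∀ v, α (σ v) (p v) = 1 := by
    intro v
    have h1 : σ v • p v = v := by simp [p]
    simp only [α]
    rw [h1, hσ1 (p v) (hσS v), mul_one, inv_mul_cancel, hpS _ (hσS v)]
    exact (hφ _ (hσS v)).map_one
  have hρ : ∀ q : Quotient (MulAction.orbitRel G E), ∃ r : E, Quotient.mk _ r = q ∧
      (T.IsInner G S r → T.ι r ∈ S ∧ T.τ r ∈ S) := by
    intro q
    induction q using Quotient.inductionOn with
    | h e =>
      by_cases he : T.IsInner G S e
      · obtain ⟨g, hg⟩ := he
        exact ⟨g • e, Quotient.sound ⟨g, rfl⟩, fun _ => hg⟩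
      · exact ⟨e, rfl, fun h => absurd h he⟩
  choose ρ hρ hρS using hρ
  let q : E → E := fun e => ρ (Quotient.mk _ e)
  have hq : ∀ (g : G) e, q (g • e) = q e := fun g e =>
    congrArg ρ (Quotient.sound ⟨g, rfl⟩)
  have hu : ∀ e, ∃ u : G, u • q e = e := fun e => by
    obtain ⟨g, hg⟩ := Quotient.exact (hρ (Quotient.mk _ e))
    exact ⟨g⁻¹, by rw [inv_smul_eq_iff]; exact hg.symm⟩
  choose u hu using hu
  have hinner : ∀ e, T.IsInner G S (q e) ↔ T.IsInner G S e := fun e => by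
    conv_rhs => rw [← hu e]
    exact (isInner_smul _).symm
  have hcq : ∀ e, c (q e) = c e := fun e => by
    conv_rhs => rw [← hu e, hc]
  have hkill : ∀ e, ¬ T.IsInner G S e → ∀ x, (x = T.ι e ∨ x = T.τ e) →
      ∀ h ∈ MulAction.stabilizer G e, α h x = 1 := by
    intro e he x hx h hh
    have hhx : h ∈ MulAction.stabilizer G x := by
      have := (hact.mem_stabilizer_edge_iff hT rfl).1 hh
      rcases hx with rfl | rfl
      · exact this.1
      · exact this.2
    simp only [α]
    rw [MulAction.mem_stabilizer_iff.1 hhx]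
    refine hout ((σ x)⁻¹ • e) (fun h => he ((isInner_smul _).1 h)) _ (hσS x) ?_ _ ?_
    · rw [hact.ι_smul, hact.τ_smul]
      rcases hx with h | h
      · exact Or.inl (by rw [← h])
      · exact Or.inr (by rw [← h])
    · rw [MulAction.mem_stabilizer_iff] at hh ⊢
      simp [mul_smul, hh]
  -- This makes the transport independent of the choice of `u e`: over inner edges it is
  -- compatibility, over outer edges both sides are `c e`.
  have hkey : ∀ e, ∀ h ∈ MulAction.stabilizer G (q e),
      α h (T.τ (q e)) * c e = c e * α h (T.ι (q e)) := by
    intro e h hh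
    by_cases he : T.IsInner G S (q e)
    · have h1 := hρS _ he
      have h2 := (hact.mem_stabilizer_edge_iff hT rfl).1 hh
      rw [hc1 e ((hinner e).1 he), mul_one, one_mul, hαS _ h1.2 h h2.2, hαS _ h1.1 h h2.1]
      exact (hin (q e) h1.1 h1.2 h hh).symm
    · rw [hkill _ he _ (Or.inr rfl) h hh, hkill _ he _ (Or.inl rfl) h hh, one_mul, mul_one]
  let β : E → L := fun e => α (u e) (T.τ (q e)) * c e * (α (u e) (T.ι (q e)))⁻¹
  have hβ : ∀ g e, α g (T.τ e) * β e = β (g • e) * α g (T.ι e) := by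
    intro g e
    simp only [β]
    rw [hq, hc]
    let h : G := (u (g • e))⁻¹ * (g * u e)
    have hh : h ∈ MulAction.stabilizer G (q e) := by
      rw [MulAction.mem_stabilizer_iff]
      simp only [h, mul_smul, hu]
      rw [inv_smul_eq_iff, ← hq g e, hu]
    have h1 : g * u e = u (g • e) * h := by simp [h]
    have h2 := (hact.mem_stabilizer_edge_iff hT rfl).1 hh
    simp only [MulAction.mem_stabilizer_iff] at h2
    have hτ : α g (T.τ e) * α (u e) (T.τ (q e)) =
        α (u (g • e)) (T.τ (q e)) * α h (T.τ (q e)) := by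
      have := hα g (u e) (T.τ (q e))
      rw [← hact.τ_smul, hu] at this
      rw [← this, h1, hα, h2.2]
    have hι : α g (T.ι e) * α (u e) (T.ι (q e)) =
        α (u (g • e)) (T.ι (q e)) * α h (T.ι (q e)) := by
      have := hα g (u e) (T.ι (q e))
      rw [← hact.ι_smul, hu] at this
      rw [← this, h1, hα, h2.1]
    have hι' : α g (T.ι e) = α (u (g • e)) (T.ι (q e)) * α h (T.ι (q e)) *
        (α (u e) (T.ι (q e)))⁻¹ := by
      rw [← hι, mul_inv_cancel_right]
    rw [hι', ← mul_assoc, ← mul_assoc, hτ, mul_assoc (α (u (g • e)) (T.τ (q e))), hkey e h hh]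
    group
  obtain ⟨r, hr⟩ : S.Nonempty := by
    obtain ⟨v⟩ := hT.isTree.connected.nonempty
    exact ⟨_, hσS v⟩
  obtain ⟨f, b, hb0, hbe, hf⟩ := hact.exists_hom_of_cocycle hT r α hα β hβ
  have hβS : ∀ e, T.ι e ∈ S → T.τ e ∈ S → β e = 1 := by
    intro e h1 h2
    have he : T.IsInner G S e := ⟨1, by simpa using ⟨h1, h2⟩⟩
    have h3 := hρS _ ((hinner e).2 he)
    have h4 : q e = e := by
      apply hT.no_multi
      have h5 := hS.unique _ h3.1 _ h1 (u e) (by rw [← hact.ι_smul, hu])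
      have h6 := hS.unique _ h3.2 _ h2 (u e) (by rw [← hact.τ_smul, hu])
      exact congrArg₂ _ h5 h6
    have h5 : u e ∈ MulAction.stabilizer G e := by
      have := hu e
      rwa [h4] at this
    have h6 := (hact.mem_stabilizer_edge_iff hT rfl).1 h5
    simp only [β]
    rw [h4, hc1 e he, mul_one, hαS _ h2 _ h6.2, hαS _ h1 _ h6.1, hin e h1 h2 _ h5, mul_inv_cancel]
  obtain ⟨R, hR⟩ := hT.isTree.exists_rooting r
  -- By convexity the path from `s` to `r` uses only edges within `S`, where `β` is trivial.
  have hbS : ∀ s, s ∈ S → b s = 1 := by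
    intro s
    refine R.induction (P := fun s => s ∈ S → b s = 1) (fun _ => hb0) (fun v hv ih hvS => ?_) s
    have hpar := hR S hS.convex hr v hvS
    obtain ⟨e, he⟩ := hT.adj_iff.1 (R.adj_par v hv)
    have h1 := hbe e
    rcases Sym2.eq_iff.1 he with ⟨h2, h3⟩ | ⟨h2, h3⟩
    · rw [hβS e (h2 ▸ hvS) (h3 ▸ hpar), one_mul, h2, h3] at h1
      rw [← h1, ih hpar]
    · rw [hβS e (h2 ▸ hpar) (h3 ▸ hvS), one_mul, h2, h3] at h1
      rw [h1, ih hpar]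
  refine ⟨f, fun s hs h hh => ?_, fun e he => ?_⟩
  · rw [hf h s, MulAction.mem_stabilizer_iff.1 hh, hbS s hs, hαS s hs h hh]
    simp
  · have hfσ : ∀ v, f (σ v) = (b v)⁻¹ := by
      intro v
      have h1 : σ v • p v = v := by simp [p]
      rw [hf (σ v) (p v), h1, hασ, hbS _ (hσS v), mul_one, mul_one]
    have he' : ¬ T.IsInner G S (q e) := fun h => he ((hinner e).1 h)
    have hqq : q (q e) = q e := by
      rw [← hq (u e) (q e), hu]
    have hst : u (q e) ∈ MulAction.stabilizer G (q e) := by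
      have := hu (q e)
      rwa [hqq] at this
    -- The stable letter of the outer edge; its image is `β (q e)`, whose factors other than `c` are
    -- trivial.
    refine ⟨(σ (T.τ (q e)))⁻¹ * σ (T.ι (q e)), ?_⟩
    rw [map_mul, map_inv, hfσ, hfσ, hbe]
    simp only [β]
    rw [hqq, hkill _ he' _ (Or.inl rfl) _ hst, hkill _ he' _ (Or.inr rfl) _ hst, hcq]
    group

/-- Extension of compatible homomorphisms from a subtree containing the root to the whole tree, along
retractions of the vertex stabilizers onto the edge stabilizers. -/
theorem exists_family {X : SimpleGraph V} {L : Type*} [Group L] {r : V} (R : X.Rooting r)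
    (hret : ∀ u w, X.Adj u w → ∃ p : G → G, MulOn (MulAction.stabilizer G u) p ∧
      (∀ x ∈ MulAction.stabilizer G u,
        p x ∈ MulAction.stabilizer G u ∧ p x ∈ MulAction.stabilizer G w) ∧
      ∀ x ∈ MulAction.stabilizer G u, x ∈ MulAction.stabilizer G w → p x = x)
    (W : Set V) (hr : r ∈ W) (hW : ∀ w ∈ W, w ≠ r → R.par w ∈ W) (ψ : V → G → L)
    (hψ : ∀ w ∈ W, MulOn (MulAction.stabilizer G w) (ψ w))
    (hc : ∀ w ∈ W, w ≠ r → ∀ h ∈ MulAction.stabilizer G w, h ∈ MulAction.stabilizer G (R.par w) →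
      ψ w h = ψ (R.par w) h) :
    ∃ φ : V → G → L, (∀ w ∈ W, φ w = ψ w) ∧ (∀ v, MulOn (MulAction.stabilizer G v) (φ v)) ∧
      (∀ u w, X.Adj u w → ∀ h ∈ MulAction.stabilizer G u, h ∈ MulAction.stabilizer G w →
        φ u h = φ w h) ∧
      ∀ v ∉ W, (∀ h ∈ MulAction.stabilizer G (R.par v), φ (R.par v) h = 1) →
        ∀ h ∈ MulAction.stabilizer G v, φ v h = 1 := by
  classical
  have hret' : ∀ v, ∃ p : G → G, v ≠ r → (MulOn (MulAction.stabilizer G v) p ∧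
      (∀ x ∈ MulAction.stabilizer G v,
        p x ∈ MulAction.stabilizer G v ∧ p x ∈ MulAction.stabilizer G (R.par v)) ∧
      ∀ x ∈ MulAction.stabilizer G v, x ∈ MulAction.stabilizer G (R.par v) → p x = x) := by
    intro v
    by_cases hv : v = r
    · exact ⟨id, fun h => absurd hv h⟩
    · obtain ⟨p, hp⟩ := hret _ _ (R.adj_par v hv)
      exact ⟨p, fun _ => hp⟩
  choose p hp using hret'
  -- Outside `W`, retract to the edge group and apply the homomorphism of the parent.
  obtain ⟨φ, h0, h1⟩ := R.exists_recursion (ψ r) (fun v F => if v ∈ W then ψ v else F ∘ p v)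
  have hφW : ∀ w ∈ W, φ w = ψ w := by
    intro w hw
    by_cases hwr : w = r
    · rw [hwr, h0]
    · rw [h1 w hwr, if_pos hw]
  have hφn : ∀ v ∉ W, φ v = φ (R.par v) ∘ p v := fun v hv => by
    rw [h1 v (fun h => hv (h ▸ hr)), if_neg hv]
  have hpar : ∀ v, v ≠ r → ∀ h ∈ MulAction.stabilizer G v, h ∈ MulAction.stabilizer G (R.par v) →
      φ v h = φ (R.par v) h := by
    intro v hv h hh hh'
    by_cases hvW : v ∈ W
    · rw [hφW v hvW, hφW _ (hW v hvW hv)]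
      exact hc v hvW hv h hh hh'
    · rw [hφn v hvW, Function.comp_apply, (hp v hv).2.2 h hh hh']
  refine ⟨φ, hφW, fun v => ?_, fun u w huw h hu hw => ?_, fun v hv h1 h hh => ?_⟩
  · refine R.induction (P := fun v => MulOn (MulAction.stabilizer G v) (φ v)) (h0 ▸ hψ r hr)
      (fun v hv ih => ?_) v
    by_cases hvW : v ∈ W
    · rw [hφW v hvW]
      exact hψ v hvW
    · rw [hφn v hvW]
      intro x hx y hy
      obtain ⟨m1, m2, -⟩ := hp v hv
      simp only [Function.comp_apply]
      rw [m1 x hx y hy, ih _ (m2 x hx).2 _ (m2 y hy).2]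
  · rcases R.par_of_adj u w huw with ⟨h1, h2⟩ | ⟨h1, h2⟩
    · rw [← h2]
      exact hpar u h1 h hu (h2 ▸ hw)
    · rw [← h2]
      exact (hpar w h1 h hw (h2 ▸ hu)).symm
  · rw [hφn v hv]
    exact h1 _ ((hp v fun h => hv (h ▸ hr)).2.1 h hh).2

/-- A subgroup containing the vertex stabilizers over a tree transversal and enough stable letters is
the whole group. -/
theorem IsTreeTransversal.eq_top {S : Set V} (hS : T.IsTreeTransversal G S) (hT : T.IsTree)
    (hact : T.IsAction G) (H : Subgroup G) (hst : ∀ s ∈ S, MulAction.stabilizer G s ≤ H)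
    (hout : ∀ e, ¬ T.IsInner G S e → ∀ x ∈ S, ∀ y, s(T.ι e, T.τ e) = s(x, y) →
      ∃ t ∈ H, t • y ∈ S) : H = ⊤ := by
  have hedge : ∀ e, ∀ x ∈ S, ∀ y, s(T.ι e, T.τ e) = s(x, y) → ∃ t ∈ H, t • y ∈ S := by
    intro e x hx y he
    by_cases hi : T.IsInner G S e
    · obtain ⟨g, hg1, hg2⟩ := hi
      have h1 := hact.map_ends g he
      have h2 : g • x ∈ S ∧ g • y ∈ S := by
        rcases Sym2.eq_iff.1 h1 with ⟨h3, h4⟩ | ⟨h3, h4⟩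
        · exact ⟨h3 ▸ hg1, h4 ▸ hg2⟩
        · exact ⟨h4 ▸ hg2, h3 ▸ hg1⟩
      -- `x` and `g • x` both lie in `S`, so `g` fixes `x`.
      refine ⟨g, hst x hx ?_, h2.2⟩
      exact (hS.unique x hx _ h2.1 g rfl).symm
    · exact hout e hi x hx y he
  obtain ⟨v⟩ := hT.isTree.connected.nonempty
  obtain ⟨k, hr⟩ := hS.cover v
  obtain ⟨R, -⟩ := hT.isTree.exists_rooting (k • v)
  have hall : ∀ w, ∃ h ∈ H, h • w ∈ S := by
    intro w
    refine R.induction (P := fun w => ∃ h ∈ H, h • w ∈ S) ⟨1, one_mem _, by simpa using hr⟩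
      (fun w hw ih => ?_) w
    obtain ⟨h, hh, hhS⟩ := ih
    obtain ⟨e, he⟩ := hT.adj_iff.1 (R.adj_par w hw).symm
    obtain ⟨t, ht, htS⟩ := hedge (h • e) _ hhS _ (hact.map_ends h he)
    exact ⟨t * h, mul_mem ht hh, by rwa [mul_smul]⟩
  rw [eq_top_iff]
  intro g _
  obtain ⟨h, hh, hhS⟩ := hall (g • k • v)
  have h1 : h * g ∈ MulAction.stabilizer G (k • v) := by
    rw [MulAction.mem_stabilizer_iff, mul_smul]
    exact (hS.unique _ hr _ hhS (h * g) (by rw [mul_smul])).symm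
  have h2 := hst _ hr h1
  exact (Subgroup.mul_mem_cancel_left H hh).1 h2

/-- Every path-convex set meeting each orbit at most once extends to a tree transversal. -/
theorem exists_isTreeTransversal (hT : T.IsTree) (hact : T.IsAction G) {S₀ : Set V}
    (hne : S₀.Nonempty) (hconv : T.toSimpleGraph.PathConvex S₀)
    (hu : ∀ u ∈ S₀, ∀ w ∈ S₀, ∀ g : G, g • u = w → u = w) :
    ∃ S, S₀ ⊆ S ∧ T.IsTreeTransversal G S := by
  let P : Set (Set V) :=
    {S | T.toSimpleGraph.PathConvex S ∧ ∀ u ∈ S, ∀ w ∈ S, ∀ g : G, g • u = w → u = w}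
  have hP : ∀ C ⊆ P, IsChain (· ⊆ ·) C → C.Nonempty → ∃ ub ∈ P, ∀ s ∈ C, s ⊆ ub := by
    intro C hC hch hCne
    refine ⟨⋃₀ C, ⟨?_, ?_⟩, fun s hs => Set.subset_sUnion_of_mem hs⟩
    · intro u w p hp hu hw x hx
      obtain ⟨A, hA, huA⟩ := hu
      obtain ⟨B, hB, hwB⟩ := hw
      obtain ⟨D, hD, h1, h2⟩ := hch.directedOn A hA B hB
      exact ⟨D, hD, (hC hD).1 p hp (h1 huA) (h2 hwB) x hx⟩
    · rintro u ⟨A, hA, huA⟩ w ⟨B, hB, hwB⟩ g hg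
      obtain ⟨D, hD, h1, h2⟩ := hch.directedOn A hA B hB
      exact (hC hD).2 u (h1 huA) w (h2 hwB) g hg
  obtain ⟨S, hS₀, hmax⟩ := zorn_subset_nonempty P hP S₀ ⟨hconv, hu⟩
  obtain ⟨hSc, hSu⟩ := hmax.prop
  refine ⟨S, hS₀, hSc, ?_, hSu⟩
  obtain ⟨r, hr⟩ := hne
  obtain ⟨R, -⟩ := hT.isTree.exists_rooting r
  intro v
  refine R.induction (P := fun w => ∃ g : G, g • w ∈ S) ⟨1, by simpa using hS₀ hr⟩
    (fun w hw ih => ?_) v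
  obtain ⟨g, hg⟩ := ih
  by_contra hn
  have hn' : ∀ k : G, k • w ∉ S := fun k hk => hn ⟨k, hk⟩
  -- `g • w` is adjacent to `S` and its orbit misses `S`; adjoining it contradicts maximality.
  have h1 := hSc.insert hT.isTree hg (hact.adj_smul hT g (R.adj_par w hw))
  refine hn' g (hmax.le_of_ge ⟨h1, ?_⟩ (Set.subset_insert _ _) (Set.mem_insert _ _))
  rintro a (rfl | ha) b (rfl | hb) k hk
  · rfl
  · exact absurd (by rw [mul_smul, hk]; exact hb) (hn' (k * g))
  · refine absurd ?_ (hn' (k⁻¹ * g))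
    rw [mul_smul, ← hk, inv_smul_smul]
    exact ha
  · exact hSu a ha b hb k hk

end OrientedGraph

/-! ### Tame actions; the case without outer edges -/

namespace OrientedGraph

/-- An action on a tree whose vertex stabilizers are free abelian of bounded rank with edge
stabilizers as direct factors, of a group in which commuting conjugate elements are equal. -/
structure IsTame {V E : Type*} (T : OrientedGraph V E) (G : Type*) [Group G] [MulAction G V]
    [MulAction G E] (M : ℕ) : Prop where
  tree : T.IsTree
  act : T.IsAction G
  vert : ∀ v : V, IsFreeAbelianOfRankLE (MulAction.stabilizer G v) M
  edge : ∀ e : E,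
    (MulAction.stabilizer G e).IsDirectFactorOf (MulAction.stabilizer G (T.ι e)) ∧
    (MulAction.stabilizer G e).IsDirectFactorOf (MulAction.stabilizer G (T.τ e))
  conj : ∀ x y z : G, x * y = y * x → z * x * z⁻¹ = y → x = y

variable {G V E : Type*} [Group G] [MulAction G V] [MulAction G E] {T : OrientedGraph V E} {M : ℕ}

theorem IsTame.comm (h : T.IsTame G M) {v : V} {x y : G} (hx : x ∈ MulAction.stabilizer G v)
    (hy : y ∈ MulAction.stabilizer G v) : x * y = y * x :=
  congrArg Subtype.val ((h.vert v).comm ⟨x, hx⟩ ⟨y, hy⟩)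

theorem IsTame.exists_edge (h : T.IsTame G M) {u w : V} (huw : T.toSimpleGraph.Adj u w) :
    ∃ e : E, (MulAction.stabilizer G e).IsDirectFactorOf (MulAction.stabilizer G u) ∧
      ∀ g, g ∈ MulAction.stabilizer G e ↔
        g ∈ MulAction.stabilizer G u ∧ g ∈ MulAction.stabilizer G w := by
  obtain ⟨e, he⟩ := h.tree.adj_iff.1 huw
  refine ⟨e, ?_, fun g => h.act.mem_stabilizer_edge_iff h.tree he⟩
  rcases Sym2.eq_iff.1 he with ⟨rfl, rfl⟩ | ⟨rfl, rfl⟩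
  · exact (h.edge e).1
  · exact (h.edge e).2

theorem IsTame.exists_retraction (h : T.IsTame G M) (u w : V) (huw : T.toSimpleGraph.Adj u w) :
    ∃ p : G → G, MulOn (MulAction.stabilizer G u) p ∧
      (∀ x ∈ MulAction.stabilizer G u,
        p x ∈ MulAction.stabilizer G u ∧ p x ∈ MulAction.stabilizer G w) ∧
      ∀ x ∈ MulAction.stabilizer G u, x ∈ MulAction.stabilizer G w → p x = x := by
  obtain ⟨e, he, hm⟩ := h.exists_edge huw
  obtain ⟨p, q, h1, h2, -, h4, -, -⟩ := he.exists_mul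
  exact ⟨p, h2, fun x hx => (hm _).1 (h1 x hx).1, fun x hx hx' => (h4 x ((hm x).2 ⟨hx, hx'⟩)).1⟩

/-- An element of `G_u` outside the edge stabilizer `G_u ∩ G_w` is detected by a character of `G_u`
vanishing on the edge stabilizer. -/
theorem IsTame.exists_character (h : T.IsTame G M) {u w : V} (huw : T.toSimpleGraph.Adj u w) {x : G}
    (hx : x ∈ MulAction.stabilizer G u) (hx' : x ∉ MulAction.stabilizer G w) :
    ∃ χ : G → Multiplicative ℤ, MulOn (MulAction.stabilizer G u) χ ∧
      (∀ g ∈ MulAction.stabilizer G u, g ∈ MulAction.stabilizer G w → χ g = 1) ∧ χ x ≠ 1 := by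
  classical
  obtain ⟨e, he, hm⟩ := h.exists_edge huw
  obtain ⟨p, q, h1, h2, h3, h4, h5, h6⟩ := he.exists_mul
  have hq : (⟨q x, h6 x hx⟩ : MulAction.stabilizer G u) ≠ 1 := fun hq =>
    hx' ((hm x).1 (h5 x hx (congrArg Subtype.val hq))).2
  obtain ⟨f, hf⟩ := (h.vert u).exists_hom_ne hq
  refine ⟨fun g => if hg : g ∈ MulAction.stabilizer G u then f ⟨q g, h6 g hg⟩ else 1,
    fun a ha b hb => ?_, fun g hg hg' => ?_, ?_⟩
  · simp only [ha, hb, mul_mem ha hb, dite_true]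
    rw [← map_mul]
    exact congrArg f (Subtype.ext (h3 a ha b hb))
  · simp only [hg, dite_true]
    rw [← map_one f]
    exact congrArg f (Subtype.ext (h4 g ((hm g).2 ⟨hg, hg'⟩)).2)
  · simp only [hx, dite_true]
    exact hf

/-- The powers of the `i`-th generator prescribed by a character. -/
def freePow {K : Type*} (i : Fin 2) (χ : K → Multiplicative ℤ) (g : K) : FreeGroup (Fin 2) :=
  FreeGroup.of i ^ (χ g).toAdd

theorem mulOn_freePow {A : Subgroup G} {χ : G → Multiplicative ℤ} (i : Fin 2) (h : MulOn A χ) :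
    MulOn A (freePow i χ) := fun x hx y hy => by
  rw [freePow, h x hx y hy, toAdd_mul, zpow_add]
  rfl

theorem freePow_eq_one {K : Type*} {χ : K → Multiplicative ℤ} (i : Fin 2) {g : K} (h : χ g = 1) :
    freePow i χ g = 1 := by
  simp [freePow, h]

theorem freePow_not_comm {K : Type*} (χ : K → Multiplicative ℤ) {x : K} (hx : χ x ≠ 1) :
    freePow 0 χ x * FreeGroup.of 1 ≠ FreeGroup.of 1 * freePow 0 χ x := by
  have := freeGroup_zpow_not_comm (m := (χ x).toAdd) (l := 1)
    (fun e => hx (Multiplicative.toAdd.injective e)) one_ne_zero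
  simpa [freePow] using this

theorem mulOn_one {L : Type*} [Group L] (A : Subgroup G) : MulOn A (fun _ => (1 : L)) :=
  fun _ _ _ _ => (mul_one 1).symm

/-- All homomorphisms to the free group of rank two have commutative image. -/
def OnlyCommImages (G : Type*) [Group G] : Prop :=
  ∀ (f : G →* FreeGroup (Fin 2)) (x y : G), f x * f y = f y * f x

/-- Kill all vertex groups: stable letters of two different orbits could then be sent to the two
generators. -/
theorem IsTreeTransversal.outer_orbit {S : Set V} (hS : T.IsTreeTransversal G S)
    (h : T.IsTame G M) (hN : OnlyCommImages G) {e₁ e₂ : E} (h1 : ¬ T.IsInner G S e₁)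
    (h2 : ¬ T.IsInner G S e₂) : ∃ g : G, g • e₁ = e₂ := by
  classical
  by_contra hne
  obtain ⟨f, -, hf⟩ := hS.exists_hom h.tree h.act (fun _ _ => (1 : FreeGroup (Fin 2)))
    (fun s _ => mulOn_one _) (fun _ _ _ _ _ => rfl) (fun _ _ _ _ _ _ _ => rfl)
    (fun e => if ∃ g : G, g • e₁ = e then FreeGroup.of 0 else if T.IsInner G S e then 1 else
      FreeGroup.of 1) (fun g e => by
        have : (∃ k : G, k • e₁ = g • e) ↔ ∃ k : G, k • e₁ = e :=
          ⟨fun ⟨k, hk⟩ => ⟨g⁻¹ * k, by rw [mul_smul, hk, inv_smul_smul]⟩,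
            fun ⟨k, hk⟩ => ⟨g * k, by rw [mul_smul, hk]⟩⟩
        simp only [this, isInner_smul])
    (fun e he => by
      have : ¬ ∃ k : G, k • e₁ = e := by
        rintro ⟨k, rfl⟩
        exact h1 ((isInner_smul k).1 he)
      simp only [this, he, if_true, if_false])
  obtain ⟨t₁, ht₁⟩ := hf e₁ h1
  obtain ⟨t₂, ht₂⟩ := hf e₂ h2
  rw [if_pos ⟨1, one_smul _ _⟩] at ht₁
  rw [if_neg hne, if_neg h2] at ht₂
  have := hN f t₁ t₂
  rw [ht₁, ht₂] at this
  exact freeGroup_zpow_not_comm one_ne_zero one_ne_zero (by simpa using this)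

/-- If there are no outer edges, then along a path in the transversal the stabilizers cannot drop at
the beginning and rise at the end. -/
theorem IsTreeTransversal.not_drop_rise {S : Set V} (hS : T.IsTreeTransversal G S)
    (h : T.IsTame G M) (hN : OnlyCommImages G) (hin : ∀ e, T.IsInner G S e) {m : ℕ} {v : ℕ → V}
    (hv : T.toSimpleGraph.IsPathSeq (m + 1) v) (hvS : ∀ i, v i ∈ S) {x y : G}
    (hx : x ∈ MulAction.stabilizer G (v 0)) (hx' : x ∉ MulAction.stabilizer G (v 1))
    (hy : y ∈ MulAction.stabilizer G (v (m + 1))) : y ∈ MulAction.stabilizer G (v m) := by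
  classical
  by_contra hy'
  obtain ⟨χ, c1, c2, c3⟩ := h.exists_character (hv.adj 0 (by omega)) hx hx'
  obtain ⟨ξ, d1, d2, d3⟩ := h.exists_character (hv.adj m (by omega)).symm hy hy'
  obtain ⟨R, hR⟩ := h.tree.isTree.exists_rooting (v 0)
  have hne : ∀ i ≤ m, v (i + 1) ≠ v 0 := fun i hi e => by
    have := hv.inj (i + 1) (by omega) 0 (by omega) e
    omega
  have hne' : ∀ i ≤ m, v i ≠ v (m + 1) := fun i hi e => by
    have := hv.inj i (by omega) (m + 1) (by omega) e
    omega
  -- Powers of different generators at the two ends, trivial in between; compatible because `χ` and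
  -- `ξ` vanish on the first and the last edge group.
  let ψ : V → G → FreeGroup (Fin 2) := fun w => if w = v 0 then freePow 0 χ else
    if w = v (m + 1) then freePow 1 ξ else fun _ => 1
  have hψ0 : ψ (v 0) = freePow 0 χ := if_pos rfl
  have hψm : ψ (v (m + 1)) = freePow 1 ξ := by simp only [ψ, if_neg (hne m le_rfl), if_true]
  have hψ1 : ∀ i < m, ψ (v (i + 1)) = fun _ => 1 := fun i hi => by
    simp only [ψ, if_neg (hne i hi.le), if_neg (hne' (i + 1) hi)]
  obtain ⟨φ, hφ1, hφ2, hφ3, -⟩ := exists_family R h.exists_retraction {x | ∃ i ≤ m + 1, x = v i}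
    ⟨0, by omega, rfl⟩
    (fun w hw _ => hR _ (hv.pathConvex h.tree.isTree) ⟨0, by omega, rfl⟩ w hw) ψ
    (by
      rintro w ⟨i, hi, rfl⟩
      rcases i with _ | i
      · rw [hψ0]
        exact mulOn_freePow _ c1
      · rcases Nat.lt_or_ge i m with him | him
        · rw [hψ1 i him]
          exact mulOn_one _
        · obtain rfl : i = m := by omega
          rw [hψm]
          exact mulOn_freePow _ d1)
    (by
      rintro w ⟨i, hi, rfl⟩ hw g hg hg'
      rcases i with _ | i
      · exact absurd rfl hw
      rw [hv.par_succ R (by omega)] at hg' ⊢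
      have hl : ψ (v (i + 1)) g = 1 := by
        rcases Nat.lt_or_ge i m with him | him
        · rw [hψ1 i him]
        · obtain rfl : i = m := by omega
          rw [hψm]
          exact freePow_eq_one _ (d2 g hg hg')
      have hr : ψ (v i) g = 1 := by
        rcases i with _ | i
        · rw [hψ0]
          exact freePow_eq_one _ (c2 g hg' hg)
        · rw [hψ1 i (by omega)]
      rw [hl, hr])
  obtain ⟨f, hf, -⟩ := hS.exists_hom h.tree h.act φ (fun s _ => hφ2 s)
    (fun e _ _ g hg => by
      have := (h.act.mem_stabilizer_edge_iff h.tree rfl).1 hg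
      exact hφ3 _ _ (h.tree.adj_edge e) g this.1 this.2)
    (fun e he => absurd (hin e) he) (fun _ => 1) (fun _ _ => rfl) (fun _ _ => rfl)
  have := hN f x y
  rw [hf _ (hvS 0) x hx, hf _ (hvS (m + 1)) y hy, hφ1 _ ⟨0, by omega, rfl⟩,
    hφ1 _ ⟨m + 1, le_rfl, rfl⟩, hψ0, hψm] at this
  exact freeGroup_zpow_not_comm (fun e => c3 (Multiplicative.toAdd.injective e))
    (fun e => d3 (Multiplicative.toAdd.injective e)) this

/-- Along a path in `S`, either the first stabilizer is contained in the next one and the path can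
be shortened, or it drops and then every element fixing the far end fixes the whole path. -/
theorem IsTreeTransversal.comm_of_forall_isInner {S : Set V} (hS : T.IsTreeTransversal G S)
    (h : T.IsTame G M) (hN : OnlyCommImages G) (hin : ∀ e, T.IsInner G S e) (a b : G) :
    a * b = b * a := by
  have key : ∀ (m : ℕ) (v : ℕ → V), T.toSimpleGraph.IsPathSeq m v → (∀ i, v i ∈ S) →
      ∀ x ∈ MulAction.stabilizer G (v 0), ∀ y ∈ MulAction.stabilizer G (v m), x * y = y * x := by
    intro m
    induction m with
    | zero => exact fun v _ _ x hx y hy => h.comm hx hy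
    | succ m ih =>
      intro v hv hvS x hx y hy
      by_cases hle : MulAction.stabilizer G (v 0) ≤ MulAction.stabilizer G (v 1)
      · exact ih (fun i => v (i + 1)) hv.tail (fun i => hvS _) x (hle hx) y hy
      · obtain ⟨z, hz, hz'⟩ := SetLike.not_le_iff_exists.1 hle
        have hdesc : ∀ i ≤ m + 1, y ∈ MulAction.stabilizer G (v i) →
            y ∈ MulAction.stabilizer G (v 0) := by
          intro i
          induction i with
          | zero => exact fun _ hy => hy
          | succ i ihi =>
            intro hi hyi
            exact ihi (by omega) (hS.not_drop_rise h hN hin (hv.mono hi) hvS hz hz' hyi)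
        exact h.comm hx (hdesc _ le_rfl hy)
  have hcomm : ∀ s ∈ S, ∀ s' ∈ S, ∀ x ∈ MulAction.stabilizer G s,
      ∀ y ∈ MulAction.stabilizer G s', x * y = y * x := by
    intro s hs s' hs' x hx y hy
    obtain ⟨m, v, hv, rfl, rfl, hvS⟩ := hS.convex.exists_isPathSeq h.tree.isTree hs hs'
    exact key m v hv hvS x hx y hy
  -- Generation by the vertex groups is used twice: first for the centralizer of one element, then
  -- for the center.
  have hcenter : Subgroup.center G = ⊤ := by
    refine hS.eq_top h.tree h.act _ (fun s hs x hx => ?_) (fun e he => absurd (hin e) he)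
    have : Subgroup.centralizer {x} = (⊤ : Subgroup G) :=
      hS.eq_top h.tree h.act _ (fun s' hs' y hy => Subgroup.mem_centralizer_singleton_iff.2
        (hcomm s' hs' s hs y hy x hx)) (fun e he => absurd (hin e) he)
    exact Subgroup.mem_center_iff.2 fun g =>
      Subgroup.mem_centralizer_singleton_iff.1 (this ▸ Subgroup.mem_top g)
  exact (Subgroup.mem_center_iff.1 (hcenter ▸ Subgroup.mem_top b) a)

end OrientedGraph

/-! ### Periodic lines; the case of one orbit of outer edges -/

namespace OrientedGraph

/-- A bi-infinite edge path, periodic under the translation `t`, whose vertices and edges represent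
distinct orbits within a period. -/
structure PeriodicLine {V E : Type*} (T : OrientedGraph V E) (G : Type*) [Group G] [MulAction G V]
    [MulAction G E] where
  n : ℕ
  t : G
  v : ℤ → V
  e : ℤ → E
  n_pos : 0 < n
  v_add : ∀ i, v (i + n) = t • v i
  e_add : ∀ i, e (i + n) = t • e i
  ends : ∀ i, s(T.ι (e i), T.τ (e i)) = s(v i, v (i + 1))
  v_orbit : ∀ i j (g : G), g • v i = v j → (n : ℤ) ∣ j - i
  e_orbit : ∀ i j (g : G), g • e i = e j → (n : ℤ) ∣ j - i

variable {G V E : Type*} [Group G] [MulAction G V] [MulAction G E] {T : OrientedGraph V E} {M : ℕ}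

/-- Translation of the indices of a periodic line. -/
def PeriodicLine.shift (l : T.PeriodicLine G) (k : ℤ) : T.PeriodicLine G where
  n := l.n
  t := l.t
  v i := l.v (i + k)
  e i := l.e (i + k)
  n_pos := l.n_pos
  v_add i := by rw [add_right_comm, l.v_add]
  e_add i := by rw [add_right_comm, l.e_add]
  ends i := by rw [add_right_comm i 1 k]; exact l.ends _
  v_orbit i j g h := by simpa using l.v_orbit _ _ g h
  e_orbit i j g h := by simpa using l.e_orbit _ _ g h

/-- An outer edge closes up a path in the transversal to a periodic line. -/
theorem IsTreeTransversal.exists_periodicLine {S : Set V} (hS : T.IsTreeTransversal G S)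
    (hT : T.IsTree) (hact : T.IsAction G) {e₀ : E} (he₀ : ¬ T.IsInner G S e₀) :
    Nonempty (T.PeriodicLine G) := by
  classical
  obtain ⟨g, hg⟩ := hS.cover (T.ι e₀)
  obtain ⟨k, hk⟩ := hS.cover (T.τ (g • e₀))
  rw [← hact.ι_smul] at hg
  rw [← isInner_smul g] at he₀
  generalize g • e₀ = e₁ at *
  -- The path runs from `k • τ e₁` to `ι e₁`. Appending `e₁` leads to `k⁻¹ • u 0`, so the period is
  -- `m + 1` and the translation is `k⁻¹`.
  obtain ⟨m, u, hu, hu0, hum, huS⟩ := hS.convex.exists_isPathSeq hT.isTree hk hg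
  have hd : ∀ i, ∃ e, i < m → s(T.ι e, T.τ e) = s(u i, u (i + 1)) := by
    intro i
    by_cases hi : i < m
    · obtain ⟨e, he⟩ := hT.adj_iff.1 (hu.adj i hi)
      exact ⟨e, fun _ => he⟩
    · exact ⟨e₁, fun h => absurd h hi⟩
  choose d hd using hd
  let D : ℕ → E := fun i => if i < m then d i else e₁
  have hD1 : ∀ i < m, s(T.ι (D i), T.τ (D i)) = s(u i, u (i + 1)) := fun i hi => by
    simp only [D, if_pos hi]
    exact hd i hi
  have hDm : D m = e₁ := if_neg (lt_irrefl m)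
  have hDinner : ∀ i < m, T.IsInner G S (D i) := fun i hi => by
    refine ⟨1, ?_⟩
    rw [one_smul]
    rcases Sym2.eq_iff.1 (hD1 i hi) with ⟨h1, h2⟩ | ⟨h1, h2⟩ <;> rw [h1, h2] <;>
      exact ⟨huS _, huS _⟩
  have hn0 : ((m + 1 : ℕ) : ℤ) ≠ 0 := by omega
  have hdiv : ∀ (q : ℤ) (r : ℕ), r ≤ m → (((m + 1 : ℕ) : ℤ) * q + r) / (m + 1 : ℕ) = q := by
    intro q r hr
    rw [add_comm, Int.add_mul_ediv_left _ _ hn0, Int.ediv_eq_zero_of_lt (by omega) (by omega), zero_add]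
  have hmod : ∀ (q : ℤ) (r : ℕ), r ≤ m →
      ((((m + 1 : ℕ) : ℤ) * q + r) % (m + 1 : ℕ)).toNat = r := by
    intro q r hr
    rw [add_comm, Int.add_mul_emod_self_left, Int.emod_eq_of_lt (by omega) (by omega)]
    simp
  have hrep : ∀ i : ℤ, ∃ (q : ℤ) (r : ℕ), r ≤ m ∧ i = ((m + 1 : ℕ) : ℤ) * q + r := by
    intro i
    have h1 := Int.emod_nonneg i hn0
    have h2 := Int.emod_lt_of_pos i (b := ((m + 1 : ℕ) : ℤ)) (by omega)
    refine ⟨i / (m + 1 : ℕ), (i % (m + 1 : ℕ)).toNat, by omega, ?_⟩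
    rw [Int.toNat_of_nonneg h1]
    exact (Int.mul_ediv_add_emod i _).symm
  let v : ℤ → V := fun i => k⁻¹ ^ (i / (m + 1 : ℕ)) • u (i % (m + 1 : ℕ)).toNat
  let e : ℤ → E := fun i => k⁻¹ ^ (i / (m + 1 : ℕ)) • D (i % (m + 1 : ℕ)).toNat
  have hv : ∀ (q : ℤ) (r : ℕ), r ≤ m → v (((m + 1 : ℕ) : ℤ) * q + r) = k⁻¹ ^ q • u r :=
    fun q r hr => by simp only [v, hdiv q r hr, hmod q r hr]
  have he : ∀ (q : ℤ) (r : ℕ), r ≤ m → e (((m + 1 : ℕ) : ℤ) * q + r) = k⁻¹ ^ q • D r :=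
    fun q r hr => by simp only [e, hdiv q r hr, hmod q r hr]
  have hshift : ∀ (q : ℤ) (r : ℕ), ((m + 1 : ℕ) : ℤ) * q + r + (m + 1 : ℕ) =
      ((m + 1 : ℕ) : ℤ) * (q + 1) + r := fun q r => by ring
  have hpow : ∀ q : ℤ, k⁻¹ ^ (q + 1) = k⁻¹ * k⁻¹ ^ q := fun q => by rw [add_comm, zpow_one_add]
  refine ⟨⟨m + 1, k⁻¹, v, e, by omega, fun i => ?_, fun i => ?_, fun i => ?_, fun i j g h => ?_,
    fun i j g h => ?_⟩⟩
  · obtain ⟨q, r, hr, rfl⟩ := hrep i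
    rw [hshift, hv _ _ hr, hv _ _ hr, hpow, mul_smul]
  · obtain ⟨q, r, hr, rfl⟩ := hrep i
    rw [hshift, he _ _ hr, he _ _ hr, hpow, mul_smul]
  · obtain ⟨q, r, hr, rfl⟩ := hrep i
    rw [he _ _ hr, hv _ _ hr]
    rcases hr.lt_or_eq with hr | rfl
    · have : ((m + 1 : ℕ) : ℤ) * q + r + 1 = ((m + 1 : ℕ) : ℤ) * q + (r + 1 : ℕ) := by push_cast; ring
      rw [this, hv _ _ hr]
      exact hact.map_ends _ (hD1 r hr)
    · have : ((r + 1 : ℕ) : ℤ) * q + r + 1 = ((r + 1 : ℕ) : ℤ) * (q + 1) + (0 : ℕ) := by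
        push_cast; ring
      rw [this, hv _ _ (by omega), hDm, hum, hu0, zpow_add_one, mul_smul, inv_smul_smul]
      exact hact.map_ends _ rfl
  · obtain ⟨q, r, hr, rfl⟩ := hrep i
    obtain ⟨q', r', hr', rfl⟩ := hrep j
    rw [hv _ _ hr, hv _ _ hr'] at h
    have h1 : u r = u r' := hS.unique _ (huS r) _ (huS r') ((k⁻¹ ^ q')⁻¹ * g * k⁻¹ ^ q) (by
      rw [mul_smul, mul_smul, h, inv_smul_smul])
    obtain rfl := hu.inj r hr r' hr' h1
    exact ⟨q' - q, by ring⟩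
  · obtain ⟨q, r, hr, rfl⟩ := hrep i
    obtain ⟨q', r', hr', rfl⟩ := hrep j
    rw [he _ _ hr, he _ _ hr'] at h
    have h1 : ((k⁻¹ ^ q')⁻¹ * g * k⁻¹ ^ q) • D r = D r' := by
      rw [mul_smul, mul_smul, h, inv_smul_smul]
    generalize (k⁻¹ ^ q')⁻¹ * g * k⁻¹ ^ q = x at h1
    have hrr : r = r' := by
      rcases hr.lt_or_eq with hr | rfl
      · rcases hr'.lt_or_eq with hr' | rfl
        · have h2 := hact.map_ends x (hD1 r hr)
          rw [h1, hD1 r' hr'] at h2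
          rcases Sym2.eq_iff.1 h2 with ⟨h3, -⟩ | ⟨h3, h4⟩
          · have := hS.unique _ (huS _) _ (huS _) x h3.symm
            exact hu.inj _ (by omega) _ (by omega) this
          · have h5 := hS.unique _ (huS _) _ (huS _) x h3.symm
            have h6 := hS.unique _ (huS _) _ (huS _) x h4.symm
            have := hu.inj _ (by omega) _ (by omega) h5
            have := hu.inj _ (by omega) _ (by omega) h6
            omega
        · rw [hDm] at h1
          exact absurd (h1 ▸ (isInner_smul x).2 (hDinner r hr)) he₀
      · rcases hr'.lt_or_eq with hr' | rfl
        · rw [hDm] at h1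
          exact absurd ((isInner_smul x).1 (h1 ▸ hDinner r' hr')) he₀
        · rfl
    subst hrr
    exact ⟨q' - q, by ring⟩

namespace PeriodicLine

variable (l : T.PeriodicLine G)

theorem adj (hT : T.IsTree) (i : ℤ) : T.toSimpleGraph.Adj (l.v i) (l.v (i + 1)) :=
  hT.adj_iff.2 ⟨_, l.ends i⟩

theorem isPathSeq (hT : T.IsTree) :
    T.toSimpleGraph.IsPathSeq (l.n - 1) (fun i : ℕ => l.v i) := by
  have hn := l.n_pos
  refine ⟨fun i _ => ?_, fun i hi j hj e => ?_⟩
  · have := l.adj hT i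
    exact_mod_cast this
  · have h1 := l.v_orbit i j 1 (by rw [one_smul]; exact e)
    have := Int.eq_zero_of_abs_lt_dvd h1 (by rw [abs_lt]; omega)
    omega

theorem exists_isTreeTransversal (hT : T.IsTree) (hact : T.IsAction G) :
    ∃ S, T.IsTreeTransversal G S ∧ ∀ i : ℕ, i < l.n → l.v i ∈ S := by
  have hn := l.n_pos
  obtain ⟨S, h1, h2⟩ := OrientedGraph.exists_isTreeTransversal (G := G) hT hact
    (S₀ := {x | ∃ i : ℕ, i ≤ l.n - 1 ∧ x = l.v i}) ⟨_, 0, by omega, rfl⟩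
    ((l.isPathSeq hT).pathConvex hT.isTree) (by
      rintro _ ⟨i, hi, rfl⟩ _ ⟨j, hj, rfl⟩ g hg
      have h1 := l.v_orbit i j g hg
      have := Int.eq_zero_of_abs_lt_dvd h1 (by rw [abs_lt]; omega)
      congr 1
      omega)
  exact ⟨S, h2, fun i hi => h1 ⟨i, by omega, rfl⟩⟩

theorem v_n_sub_one : l.v ((l.n - 1 : ℕ) : ℤ) = l.t • l.v (-1) := by
  have hn := l.n_pos
  rw [← l.v_add]
  congr 1
  omega

theorem v_n : l.v l.n = l.t • l.v 0 := by
  rw [← l.v_add, zero_add]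

theorem ends_last : s(T.ι (l.e ((l.n - 1 : ℕ) : ℤ)), T.τ (l.e ((l.n - 1 : ℕ) : ℤ))) =
    s(l.v ((l.n - 1 : ℕ) : ℤ), l.v l.n) := by
  have hn := l.n_pos
  rw [l.ends]
  congr 3
  omega

variable {l} {S : Set V}

/-- A translate of the closing edge within `S` would join `v 0` and `v (n - 1)`. This is a loop for
`n = 1`, identifies the orbits of `e 0` and `e 1` for `n = 2`, and gives a circuit for larger `n`.
-/
theorem not_isInner (hT : T.IsTree) (hact : T.IsAction G) (hS : T.IsTreeTransversal G S)
    (hl : ∀ i : ℕ, i < l.n → l.v i ∈ S) : ¬ T.IsInner G S (l.e ((l.n - 1 : ℕ) : ℤ)) := by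
  have hn := l.n_pos
  rintro ⟨g, hg1, hg2⟩
  have h1 := hact.map_ends g l.ends_last
  have h2 : g • l.v ((l.n - 1 : ℕ) : ℤ) ∈ S ∧ g • l.v l.n ∈ S := by
    rcases Sym2.eq_iff.1 h1 with ⟨h3, h4⟩ | ⟨h3, h4⟩
    · exact ⟨h3 ▸ hg1, h4 ▸ hg2⟩
    · exact ⟨h4 ▸ hg2, h3 ▸ hg1⟩
  have h3 := hS.unique _ (hl (l.n - 1) (by omega)) _ h2.1 g rfl
  have h4 := hS.unique _ (hl 0 hn) _ h2.2 (g * l.t) (by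
    rw [mul_smul, l.v_n]
    rfl)
  rw [← h3, ← h4] at h1
  have hadj := hT.adj_iff.2 ⟨_, h1⟩
  obtain ⟨R, -⟩ := hT.isTree.exists_rooting (l.v (0 : ℕ))
  have hseq := l.isPathSeq hT
  rcases Nat.lt_or_ge 1 l.n with hn1 | hn1
  · have h5 := R.par_eq_of_adj_root hadj
    have h6 := hseq.par_succ R (i := l.n - 2) (by omega)
    have h7 : l.n - 2 + 1 = l.n - 1 := by omega
    simp only [h7] at h6
    have h8 := hseq.inj _ (by omega) _ (by omega) (h6.symm.trans h5)
    have hn2 : l.n = 2 := by omega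
    have h9 := l.ends 0
    have h10 : g • l.e ((l.n - 1 : ℕ) : ℤ) = l.e 0 := by
      apply hT.no_multi
      rw [h1, h9, hn2, Sym2.eq_swap]
      rfl
    have h11 := l.e_orbit _ _ g h10
    rw [hn2] at h11
    omega
  · have : l.n - 1 = 0 := by omega
    rw [this] at hadj
    exact hadj.ne rfl

/-- All outer edges are translates of the closing edge from `v (n - 1)` to `v n = t • v 0`. An end
in `S` must be the representative of its orbit, which leaves only a stabilizer element as freedom.
-/
theorem outer_ends (h : T.IsTame G M) (hN : OnlyCommImages G) (hS : T.IsTreeTransversal G S)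
    (hl : ∀ i : ℕ, i < l.n → l.v i ∈ S) {e : E} (he : ¬ T.IsInner G S e) {x y : V} (hx : x ∈ S)
    (hxy : s(T.ι e, T.τ e) = s(x, y)) :
    (x = l.v 0 ∧ ∃ k ∈ MulAction.stabilizer G (l.v 0), y = k • l.v (-1)) ∨
    (x = l.v (l.n - 1 : ℕ) ∧ ∃ k ∈ MulAction.stabilizer G (l.v (l.n - 1 : ℕ)), y = k • l.v l.n) := by
  have hn := l.n_pos
  obtain ⟨g, rfl⟩ := hS.outer_orbit h hN (not_isInner h.tree h.act hS hl) he
  have h1 := h.act.map_ends g l.ends_last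
  rw [hxy] at h1
  rcases Sym2.eq_iff.1 h1 with ⟨h2, h3⟩ | ⟨h2, h3⟩
  · right
    have h4 := hS.unique _ (hl (l.n - 1) (by omega)) _ hx g h2.symm
    exact ⟨h4.symm, g, by rw [MulAction.mem_stabilizer_iff, ← h2, h4], h3⟩
  · left
    have h5 : (g * l.t) • l.v (0 : ℕ) = x := by
      rw [h2, mul_smul, l.v_n]
      rfl
    have h4 := hS.unique _ (hl 0 hn) _ hx _ h5
    refine ⟨h4.symm, g * l.t, ?_, ?_⟩
    · rw [MulAction.mem_stabilizer_iff]
      exact h5.trans h4.symm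
    · rw [h3, mul_smul, l.v_n_sub_one]

theorem eq_top (h : T.IsTame G M) (hN : OnlyCommImages G) (hS : T.IsTreeTransversal G S)
    (hl : ∀ i : ℕ, i < l.n → l.v i ∈ S) (H : Subgroup G)
    (hst : ∀ s ∈ S, MulAction.stabilizer G s ≤ H) (ht : l.t ∈ H) : H = ⊤ := by
  have hn := l.n_pos
  refine hS.eq_top h.tree h.act H hst fun e he x hx y hxy => ?_
  rcases outer_ends h hN hS hl he hx hxy with ⟨-, k, hk, rfl⟩ | ⟨-, k, hk, rfl⟩
  · refine ⟨l.t * k⁻¹, mul_mem ht (inv_mem (hst _ (hl 0 hn) hk)), ?_⟩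
    rw [mul_smul, inv_smul_smul, ← l.v_n_sub_one]
    exact hl _ (by omega)
  · refine ⟨l.t⁻¹ * k⁻¹, mul_mem (inv_mem ht) (inv_mem (hst _ (hl _ (by omega)) hk)), ?_⟩
    rw [mul_smul, inv_smul_smul, l.v_n, inv_smul_smul]
    exact hl 0 hn

/-- A compatible family of homomorphisms into the free group that vanishes at both ends of the outer
edges takes only values commuting with the second generator. -/
theorem family_comm (h : T.IsTame G M) (hN : OnlyCommImages G) (hS : T.IsTreeTransversal G S)
    (hl : ∀ i : ℕ, i < l.n → l.v i ∈ S) (φ : V → G → FreeGroup (Fin 2))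
    (hφ : ∀ v, MulOn (MulAction.stabilizer G v) (φ v))
    (hadj : ∀ u w, T.toSimpleGraph.Adj u w → ∀ g ∈ MulAction.stabilizer G u,
      g ∈ MulAction.stabilizer G w → φ u g = φ w g)
    (hl0 : ∀ g ∈ MulAction.stabilizer G (l.v 0), g ∈ MulAction.stabilizer G (l.v (-1)) →
      φ (l.v 0) g = 1)
    (hl1 : ∀ g ∈ MulAction.stabilizer G (l.v (l.n - 1 : ℕ)), g ∈ MulAction.stabilizer G (l.v l.n) →
      φ (l.v (l.n - 1 : ℕ)) g = 1) {s : V} (hs : s ∈ S) {x : G}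
    (hx : x ∈ MulAction.stabilizer G s) :
    φ s x * FreeGroup.of 1 = FreeGroup.of 1 * φ s x := by
  classical
  -- Elements of the abelian group `G_u` fixing `k • w` also fix `w`, so it suffices to kill the
  -- edge groups on the line itself.
  have hconj : ∀ {u w : V} {k g : G}, k ∈ MulAction.stabilizer G u →
      g ∈ MulAction.stabilizer G u → g ∈ MulAction.stabilizer G (k • w) →
      g ∈ MulAction.stabilizer G w := by
    intro u w k g hk hg hgw
    have h1 := h.comm hk hg
    rw [MulAction.mem_stabilizer_iff, ← mul_smul, ← h1, mul_smul] at hgw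
    exact MulAction.mem_stabilizer_iff.2 (smul_left_cancel _ hgw)
  have hout : ∀ e, ¬ T.IsInner G S e → ∀ x ∈ S, ∀ y, s(T.ι e, T.τ e) = s(x, y) →
      ∀ g ∈ MulAction.stabilizer G e, φ x g = 1 := by
    intro e he x hx y hxy g hg
    obtain ⟨hgx, hgy⟩ := (h.act.mem_stabilizer_edge_iff h.tree hxy).1 hg
    rcases outer_ends h hN hS hl he hx hxy with ⟨rfl, k, hk, rfl⟩ | ⟨rfl, k, hk, rfl⟩
    · exact hl0 g hgx (hconj hk hgx hgy)
    · exact hl1 g hgx (hconj hk hgx hgy)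
  obtain ⟨f, hf, hft⟩ := hS.exists_hom h.tree h.act φ (fun s _ => hφ s)
    (fun e _ _ g hg => by
      have := (h.act.mem_stabilizer_edge_iff h.tree rfl).1 hg
      exact hadj _ _ (h.tree.adj_edge e) g this.1 this.2)
    (fun e he x hx hxe g hg => by
      rcases hxe with rfl | rfl
      · exact hout e he _ hx _ rfl g hg
      · exact hout e he _ hx _ Sym2.eq_swap g hg)
    (fun e => if T.IsInner G S e then 1 else FreeGroup.of 1)
    (fun g e => by simp only [isInner_smul]) (fun e he => if_pos he)
  obtain ⟨t, ht⟩ := hft _ (not_isInner h.tree h.act hS hl)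
  rw [if_neg (not_isInner h.tree h.act hS hl)] at ht
  have := hN f x t
  rwa [hf s hs x hx, ht] at this

/-- Off the periodic line, the stabilizers decrease away from the root. -/
theorem stabilizer_le_par (h : T.IsTame G M) (hN : OnlyCommImages G) (hS : T.IsTreeTransversal G S)
    (hl : ∀ i : ℕ, i < l.n → l.v i ∈ S) (R : T.toSimpleGraph.Rooting (l.v (0 : ℕ))) {y : V}
    (hy : y ∈ S) (hyl : ∀ i : ℕ, i < l.n → y ≠ l.v i) :
    MulAction.stabilizer G y ≤ MulAction.stabilizer G (R.par y) := by
  classical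
  have hn := l.n_pos
  intro x hx
  by_contra hx'
  have hyr := hyl 0 hn
  obtain ⟨χ, c1, c2, c3⟩ := h.exists_character (R.adj_par y hyr) hx hx'
  let ψ : V → G → FreeGroup (Fin 2) := fun w => if w = y then freePow 0 χ else fun _ => 1
  have hψy : ψ y = freePow 0 χ := if_pos rfl
  have hψ1 : ∀ w, w ≠ y → ψ w = fun _ => 1 := fun w hw => if_neg hw
  -- On the ball whose radius is the depth of `y`, only `y` gets a non-trivial homomorphism. Line
  -- vertices beyond the ball inherit triviality from their parents.
  obtain ⟨φ, hφ1, hφ2, hφ3, hφ4⟩ := exists_family R h.exists_retraction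
    {w | R.depth w ≤ R.depth y} (R.depth_root.trans_le (Nat.zero_le _))
    (fun w hw hwr => by
      have := R.depth_par w hwr
      simp only [Set.mem_ofPred_eq] at hw ⊢
      omega) ψ
    (fun w _ => by
      by_cases hw : w = y
      · rw [hw, hψy]
        exact mulOn_freePow _ c1
      · rw [hψ1 w hw]
        exact mulOn_one _)
    (fun w hw hwr g hg hg' => by
      have hd := R.depth_par w hwr
      simp only [Set.mem_ofPred_eq] at hw
      have hpar : R.par w ≠ y := by
        rintro rfl
        omega
      rw [hψ1 _ hpar]
      by_cases hwy : w = y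
      · subst hwy
        rw [hψy]
        exact freePow_eq_one _ (c2 g hg hg')
      · rw [hψ1 w hwy])
  have hline : ∀ i : ℕ, i < l.n → ∀ g ∈ MulAction.stabilizer G (l.v i), φ (l.v i) g = 1 := by
    intro i
    induction i with
    | zero =>
      intro _ g _
      rw [hφ1 _ (R.depth_root.trans_le (Nat.zero_le _)), hψ1 _ hyr.symm]
    | succ i ih =>
      intro hi g hg
      by_cases hW : R.depth (l.v (i + 1 : ℕ)) ≤ R.depth y
      · rw [hφ1 _ hW, hψ1 _ (hyl _ hi).symm]
      · refine hφ4 _ hW ?_ g hg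
        rw [(l.isPathSeq h.tree).par_succ R (i := i) (by omega)]
        exact ih (by omega)
  have := family_comm h hN hS hl φ hφ2 hφ3 (fun g hg _ => hline 0 hn g hg)
    (fun g hg _ => hline _ (by omega) g hg) hy hx
  rw [hφ1 y (le_refl (R.depth y)), hψy] at this
  exact freePow_not_comm χ c3 this

/-- `x` and `t⁻¹ * x * t` both fix `v i`, so they commute; being conjugate, they are equal. -/
theorem commute_t (h : T.IsTame G M) {i : ℤ} {x : G} (hx : x ∈ MulAction.stabilizer G (l.v i))
    (hx' : x ∈ MulAction.stabilizer G (l.v (i + l.n))) : l.t * x = x * l.t := by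
  have h1 : l.t⁻¹ * x * l.t ∈ MulAction.stabilizer G (l.v i) := by
    rw [MulAction.mem_stabilizer_iff] at hx' ⊢
    rw [l.v_add] at hx'
    rw [mul_smul, mul_smul, hx', inv_smul_smul]
  have h2 := h.conj x (l.t⁻¹ * x * l.t) l.t⁻¹ (h.comm hx h1) (by rw [inv_inv])
  nth_rewrite 1 [h2]
  group

/-- Since `x` commutes with `t`, the set of indices of fixed vertices is periodic, and it contains a
full period. -/
theorem mem_stabilizer_of_period (h : T.IsTame G M) {j : ℤ} {x : G}
    (hx : ∀ i : ℕ, i ≤ l.n → x ∈ MulAction.stabilizer G (l.v (j + i))) (i : ℤ) :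
    x ∈ MulAction.stabilizer G (l.v i) := by
  have hn := l.n_pos
  have ht := commute_t (l := l) h (by simpa using hx 0 (by omega)) (hx l.n le_rfl)
  have hstep : ∀ i, x ∈ MulAction.stabilizer G (l.v (i + l.n)) ↔
      x ∈ MulAction.stabilizer G (l.v i) := by
    intro i
    rw [MulAction.mem_stabilizer_iff, MulAction.mem_stabilizer_iff, l.v_add, ← mul_smul, ← ht,
      mul_smul]
    exact smul_left_cancel_iff _
  have hmul : ∀ (i q : ℤ), x ∈ MulAction.stabilizer G (l.v (i + l.n * q)) ↔
      x ∈ MulAction.stabilizer G (l.v i) := by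
    intro i q
    induction q using Int.induction_on with
    | zero => simp
    | succ q ih =>
      rw [← ih, ← hstep (i + l.n * q)]
      ring_nf
    | pred q ih =>
      rw [← ih, ← hstep (i + l.n * (-q - 1))]
      ring_nf
  have h1 := Int.emod_nonneg (i - j) (b := (l.n : ℤ)) (by omega)
  have h2 := Int.emod_lt_of_pos (i - j) (b := (l.n : ℤ)) (by omega)
  have h3 := hx ((i - j) % l.n).toNat (by omega)
  rw [Int.toNat_of_nonneg h1] at h3
  have h4 := (hmul (j + (i - j) % l.n) ((i - j) / l.n)).2 h3
  have h5 : j + (i - j) % l.n + l.n * ((i - j) / l.n) = i := by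
    have := Int.mul_ediv_add_emod (i - j) l.n
    linarith
  rwa [h5] at h4

/-- If the stabilizers along the line are constant, the group is commutative. -/
theorem comm_of_constant (l : T.PeriodicLine G) (h : T.IsTame G M) (hN : OnlyCommImages G)
    (hl : ∀ (i : ℤ), ∀ x ∈ MulAction.stabilizer G (l.v i), ∀ j, x ∈ MulAction.stabilizer G (l.v j))
    (a b : G) : a * b = b * a := by
  have hn := l.n_pos
  obtain ⟨S, hS, hlS⟩ := l.exists_isTreeTransversal h.tree h.act
  obtain ⟨R, hR⟩ := h.tree.isTree.exists_rooting (l.v (0 : ℕ))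
  have hst : ∀ s, s ∈ S → ∀ x ∈ MulAction.stabilizer G s, ∀ j,
      x ∈ MulAction.stabilizer G (l.v j) := by
    intro s
    refine R.induction (P := fun s => s ∈ S → ∀ x ∈ MulAction.stabilizer G s, ∀ j,
      x ∈ MulAction.stabilizer G (l.v j)) (fun _ => hl _) (fun v hv ih hvS => ?_) s
    by_cases hvl : ∃ i : ℕ, i < l.n ∧ v = l.v i
    · obtain ⟨i, -, rfl⟩ := hvl
      exact hl i
    · push Not at hvl
      exact fun x hx => ih (hR S hS.convex (hlS 0 hn) v hvS) x
        (stabilizer_le_par h hN hS hlS R hvS hvl hx)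
  have hcs : ∀ s ∈ S, ∀ s' ∈ S, ∀ x ∈ MulAction.stabilizer G s,
      ∀ y ∈ MulAction.stabilizer G s', x * y = y * x := fun s hs s' hs' x hx y hy =>
    h.comm (hst s hs x hx 0) (hst s' hs' y hy 0)
  have hct : ∀ s ∈ S, ∀ x ∈ MulAction.stabilizer G s, l.t * x = x * l.t := fun s hs x hx =>
    commute_t h (hst s hs x hx 0) (hst s hs x hx _)
  have hcenter : Subgroup.center G = ⊤ := by
    refine eq_top h hN hS hlS _ (fun s hs x hx => ?_) ?_
    · have : Subgroup.centralizer {x} = (⊤ : Subgroup G) :=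
        eq_top h hN hS hlS _ (fun s' hs' y hy => Subgroup.mem_centralizer_singleton_iff.2
          (hcs s' hs' s hs y hy x hx)) (Subgroup.mem_centralizer_singleton_iff.2 (hct s hs x hx))
      exact Subgroup.mem_center_iff.2 fun g =>
        Subgroup.mem_centralizer_singleton_iff.1 (this ▸ Subgroup.mem_top g)
    · have : Subgroup.centralizer {l.t} = (⊤ : Subgroup G) :=
        eq_top h hN hS hlS _ (fun s' hs' y hy => Subgroup.mem_centralizer_singleton_iff.2
          (hct s' hs' y hy).symm) (Subgroup.mem_centralizer_singleton_iff.2 rfl)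
      exact Subgroup.mem_center_iff.2 fun g =>
        Subgroup.mem_centralizer_singleton_iff.1 (this ▸ Subgroup.mem_top g)
  exact Subgroup.mem_center_iff.1 (hcenter ▸ Subgroup.mem_top b) a

/-- If `x` fixes the first `k + 1` vertices, `k < n`, and any element fixing `k + 2` consecutive
vertices fixes the whole line, then `x` fixes the whole line. -/
theorem mem_stabilizer_of_maximal (l : T.PeriodicLine G) (h : T.IsTame G M) (hN : OnlyCommImages G)
    {k : ℕ} (hk : k < l.n) (hmax : ∀ (j : ℤ) (y : G),
      (∀ i : ℕ, i ≤ k + 1 → y ∈ MulAction.stabilizer G (l.v (j + i))) →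
        ∀ i, y ∈ MulAction.stabilizer G (l.v i))
    {x : G} (hx : ∀ i : ℕ, i ≤ k → x ∈ MulAction.stabilizer G (l.v i)) (i : ℤ) :
    x ∈ MulAction.stabilizer G (l.v i) := by
  classical
  have hn := l.n_pos
  by_contra hxi
  obtain ⟨S, hS, hlS⟩ := l.exists_isTreeTransversal h.tree h.act
  obtain ⟨R, hR⟩ := h.tree.isTree.exists_rooting (l.v (0 : ℕ))
  have hx0 : x ∈ MulAction.stabilizer G (l.v 0) := hx 0 (by omega)
  -- Otherwise `x` fixes the `k + 2` consecutive vertices from `v (-1)` to `v k`.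
  have hx1 : x ∉ MulAction.stabilizer G (l.v (-1)) := fun h1 => hxi (hmax (-1) x (fun i hi => by
    rcases i with _ | i
    · exact h1
    · have := hx i (by omega)
      convert this using 3
      push_cast
      ring) i)
  obtain ⟨χ, c1, c2, c3⟩ := h.exists_character (l.adj h.tree (-1)).symm hx0 hx1
  -- Such `y` fix the whole line, in particular `v (-1)`. This is what lets `χ` extend along the
  -- segment so as to die on the edge after `v k`.
  have hc2 : ∀ y, (∀ i : ℕ, i ≤ k + 1 → y ∈ MulAction.stabilizer G (l.v i)) → χ y = 1 := fun y hy => by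
    have := hmax 0 y (fun i hi => by simpa using hy i hi)
    exact c2 y (this _) (this _)
  obtain ⟨N, Ψ, hN0, d1, d2, d3, d4⟩ := exists_int_sequence k
    (fun i => MulAction.stabilizer G (l.v i)) (fun i => h.vert _) χ c1 hc2
  have hseq := l.isPathSeq h.tree
  let ψ : V → G → FreeGroup (Fin 2) := fun w =>
    if hw : ∃ i : ℕ, i ≤ k ∧ w = l.v i then freePow 0 (Ψ hw.choose) else fun _ => 1
  have hψ : ∀ i : ℕ, i ≤ k → ψ (l.v i) = freePow 0 (Ψ i) := by
    intro i hi
    have hw : ∃ j : ℕ, j ≤ k ∧ l.v i = l.v j := ⟨i, hi, rfl⟩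
    have h1 : hw.choose = i :=
      (hseq.inj _ (by omega) _ (by have := hw.choose_spec.1; omega) hw.choose_spec.2).symm
    simp only [ψ, dif_pos hw, h1]
  have hψ1 : ∀ i : ℕ, k < i → i < l.n → ψ (l.v i) = fun _ => 1 := by
    intro i hi hin
    refine dif_neg ?_
    rintro ⟨j, hj, e⟩
    have := hseq.inj _ (by omega) _ (by omega) e
    omega
  obtain ⟨φ, hφ1, hφ2, hφ3, -⟩ := exists_family R h.exists_retraction
    {y | ∃ i : ℕ, i ≤ l.n - 1 ∧ y = l.v i} ⟨0, by omega, rfl⟩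
    (fun w hw _ => hR _ (hseq.pathConvex h.tree.isTree) ⟨0, by omega, rfl⟩ w hw) ψ
    (by
      rintro w ⟨i, hi, rfl⟩
      rcases Nat.lt_or_ge k i with hki | hki
      · rw [hψ1 i hki (by omega)]
        exact mulOn_one _
      · rw [hψ i hki]
        exact mulOn_freePow _ (d2 i hki))
    (by
      rintro w ⟨i, hi, rfl⟩ hw g hg hg'
      rcases i with _ | i
      · exact absurd rfl hw
      rw [hseq.par_succ R (by omega)] at hg' ⊢
      rcases Nat.lt_trichotomy i k with hik | rfl | hik
      · rw [hψ _ hik, hψ _ hik.le]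
        simp only [freePow, d3 i hik g hg' hg]
      · rw [hψ1 _ (Nat.lt_succ_self i) (by omega), hψ _ le_rfl]
        exact (freePow_eq_one _ (d4 g hg' hg)).symm
      · rw [hψ1 _ (by omega) (by omega), hψ1 _ hik (by omega)])
  have hφ0 : φ (l.v 0) = freePow 0 (Ψ 0) :=
    (hφ1 (l.v (0 : ℕ)) ⟨0, by omega, rfl⟩).trans (hψ 0 (by omega))
  have := family_comm h hN hS hlS φ hφ2 hφ3
    (fun g hg hg' => by
      rw [hφ0]
      exact freePow_eq_one _ (by rw [d1 g hg, c2 g hg hg', one_zpow]))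
    (fun g hg hg' => by
      rw [hφ1 _ ⟨_, le_rfl, rfl⟩]
      rcases Nat.lt_or_ge k (l.n - 1) with hkn | hkn
      · rw [hψ1 _ hkn (by omega)]
      -- The segment fills a whole period, and the edge after `v k` is the outer edge itself.
      · obtain rfl : k = l.n - 1 := by omega
        rw [hψ _ le_rfl]
        refine freePow_eq_one _ (d4 g hg ?_)
        rwa [Nat.sub_add_cancel hn])
    (hlS 0 hn) hx0
  rw [Nat.cast_zero, hφ0] at this
  refine freePow_not_comm (Ψ 0) ?_ this
  rw [d1 x hx0]
  intro h1
  have h2 := congrArg Multiplicative.toAdd h1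
  rw [toAdd_zpow, toAdd_one, smul_eq_zero] at h2
  exact h2.elim hN0 fun h3 => c3 (Multiplicative.toAdd.injective h3)

/-- Take the least `d` such that fixing `d + 1` consecutive vertices forces fixing the line; `d = n`
qualifies. A positive `d` could be lowered by `mem_stabilizer_of_maximal`, and `d = 0` means that
stabilizers are constant. -/
theorem comm (l : T.PeriodicLine G) (h : T.IsTame G M) (hN : OnlyCommImages G) (a b : G) :
    a * b = b * a := by
  classical
  have hn := l.n_pos
  have hex : ∃ d : ℕ, ∀ (j : ℤ) (y : G),
      (∀ i : ℕ, i ≤ d → y ∈ MulAction.stabilizer G (l.v (j + i))) →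
        ∀ i, y ∈ MulAction.stabilizer G (l.v i) :=
    ⟨l.n, fun j y hy => mem_stabilizer_of_period h hy⟩
  rcases hd : Nat.find hex with _ | k
  · have h0 := Nat.find_spec hex
    rw [hd] at h0
    refine l.comm_of_constant h hN (fun i x hx => h0 i x fun i' hi' => ?_) a b
    obtain rfl : i' = 0 := by omega
    simpa using hx
  · have hmax := Nat.find_spec hex
    rw [hd] at hmax
    have hk : k < l.n := by
      have := Nat.find_min' hex fun j y hy => mem_stabilizer_of_period h hy
      omega
    refine absurd ?_ (Nat.find_min hex (m := k) (by omega))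
    intro j x hx i
    -- Shift the line so that the fixed segment starts at index `0`.
    have := (l.shift j).mem_stabilizer_of_maximal h hN hk
      (fun j' y hy i' => by
        refine hmax (j' + j) y (fun i'' hi'' => ?_) (i' + j)
        have := hy i'' hi''
        rw [add_right_comm]
        exact this)
      (x := x) (fun i' hi' => by
        have := hx i' hi'
        rw [add_comm] at this
        exact this) (i - j)
    have h2 : x ∈ MulAction.stabilizer G (l.v (i - j + j)) := this
    rwa [sub_add_cancel] at h2

end PeriodicLine

/-! ### Conclusion -/

theorem IsTame.comm_of_onlyCommImages (h : T.IsTame G M) (hN : OnlyCommImages G) (a b : G) :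
    a * b = b * a := by
  obtain ⟨v⟩ := h.tree.isTree.connected.nonempty
  obtain ⟨S, -, hS⟩ := exists_isTreeTransversal (G := G) h.tree h.act (Set.singleton_nonempty v)
    (SimpleGraph.pathConvex_singleton v) (by
      rintro u hu w hw - -
      exact (Set.mem_singleton_iff.1 hu).trans (Set.mem_singleton_iff.1 hw).symm)
  by_cases hin : ∀ e, T.IsInner G S e
  · exact hS.comm_of_forall_isInner h hN hin a b
  · push Not at hin
    obtain ⟨e, he⟩ := hin
    obtain ⟨l⟩ := hS.exists_periodicLine h.tree h.act he
    exact l.comm h hN a b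

end OrientedGraph

theorem theorem5p1 {G V E : Type*} [Group G] [MulAction G V] [MulAction G E]
    (T : OrientedGraph V E) (hT : T.IsTree) (hact : T.IsAction G)
    (hvert : ∃ M : ℕ, ∀ v : V, IsFreeAbelianOfRankLE (MulAction.stabilizer G v) M)
    (hedge : ∀ e : E,
      (MulAction.stabilizer G e).IsDirectFactorOf (MulAction.stabilizer G (T.ι e)) ∧
      (MulAction.stabilizer G e).IsDirectFactorOf (MulAction.stabilizer G (T.τ e)))
    (hconj : ∀ x y z : G, x * y = y * x → z * x * z⁻¹ = y → x = y)
    (hsolv : ¬ Group.IsSolvable G) :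
    ∃ f : G →* FreeGroup (Fin 2), Function.Surjective f := by
  obtain ⟨M, hM⟩ := hvert
  have htame : T.IsTame G M := ⟨hT, hact, hM, hedge, hconj⟩
  by_contra hn
  refine hsolv (Group.isSolvable_of_comm (htame.comm_of_onlyCommImages fun f x y => ?_))
  by_contra hxy
  exact hn (exists_surjective_freeGroup_two_of_not_comm f hxy)
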